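/- Let $X$ be a finite rack, that is, a finite set with an operation $\triangleright$ such that $t\triangleright(s\triangleright r)=(t\triangleright s)\triangleright(t\triangleright r)$ and all maps $s\mapsto t\triangleright s$ are bijective. Let $\mathbb K$ be a field of arbitrary characteristic, and let $\chi:X\times X\to\mathbb K^\times$ be a 2-cocycle, i.e. $\chi(t,s\triangleright r)\,\chi(s,r)=\chi(t\triangleright s,t\triangleright r)\,\chi(t,r)$ for all $t,s,r\in X$. Assume that all diagonal elements $\chi(t,t)$, $t\in X$, have the same multiplicative order $m$ and that $\chi(t\triangleright t,t\triangleright t)=\chi(t,t)$ for all $t\in X$ (this second condition is automatic if $X$ is a quandle, i.e. $t\triangleright t=t$ for all $t$, and also if $\chi(t,t)$ does not depend on $t$). Let $V$ be the vector space with basis $(e_t)_{t\in X}$ and braiding $c(e_t\otimes e_s)=\chi(t,s)\,e_{t\triangleright s}\otimes e_t$. The tensor algebra $TV$ carries the unique comultiplication $\Delta$ for which the elements of $V$ are primitive and which is an algebra homomorphism into $TV\otimes TV$ with the braided product $(\mu\otimes\mu)(\mathrm{id}\otimes c\otimes\mathrm{id})$, where $c$ also denotes the extension of the braiding to $TV$.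 Let $I$ be the largest homogeneous two-sided ideal of $TV$ contained in $\bigoplus_{j\ge 2}V^{\otimes j}$ with $\Delta(I)\subseteq I\otimes TV+TV\otimes I$, and let $\mathfrak B=TV/I$ be the Nichols algebra, graded by $\mathbb N_0$ with $\mathfrak B(j)$ the image of $V^{\otimes j}$. For a subset $X'\subseteq X$ let $\mathfrak B'$ be the unital subalgebra of $\mathfrak B$ generated by the $e_t$ with $t\in X'$ (for a subrack $X'$ this is the corresponding Nichols subalgebra). Put $$\mathcal H_{\mathfrak B}(t)=\sum_{j\ge 0}\dim\mathfrak B(j)\,t^j,\qquad \mathcal H_{\mathfrak B'}(t)=\sum_{j\ge 0}\dim(\mathfrak B'\cap\mathfrak B(j))\,t^j,\qquad (m)_t=\sum_{j=0}^{m-1}t^j .$$ Assume that $\mathfrak B$ is finite-dimensional. Then for every non-empty proper subrack $X'$ of $X$ there is a polynomial $p(t)\in\mathbb Z[t]$ with $$\mathcal H_{\mathfrak B}(t)=(m)_t\cdot\mathcal H_{\mathfrak B'}(t)\cdot p(t).$$ -/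

import Mathlib

open scoped TensorProduct Quandles

/-- A subset of a rack which is itself a rack under the restricted operation: it is closed under
`▷`, and each of its elements acts on it bijectively. -/
def IsSubrack {X : Type*} [Rack X] (S : Set X) : Prop :=
  ∀ t ∈ S, Set.BijOn (fun s => t ◃ s) S S

/-- A rack 2-cocycle with values in the non-zero scalars of `K`. -/
structure RackCocycle (X K : Type*) [Rack X] [Field K] where
  val : X → X → Kˣ
  cocycle : ∀ t s r : X, val t (s ◃ r) * val s r = val (t ◃ s) (t ◃ r) * val t r

namespace RackCocycle

noncomputable section

variable {X K : Type*} [Rack X] [Field K] (χ : RackCocycle X K)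

/-- The free algebra on `X` is the tensor algebra `TV` of the vector space `V = K X`, with
basis `e_t = FreeAlgebra.ι K t`. This is the automorphism `g_t` of `TV` extending the action
`g_t (e_s) = χ(t,s) e_{t ▷ s}` on `V`. -/
def act (t : X) : FreeAlgebra K X →ₐ[K] FreeAlgebra K X :=
  FreeAlgebra.lift K fun s => ((χ.val t s : Kˣ) : K) • FreeAlgebra.ι K (t ◃ s)

/-- Left multiplication by `1 ⊗ a` on the braided tensor product algebra `TV ⊗ TV`.
For a word `w = e_{t₁} ⋯ e_{t_k}` it is `x ⊗ y ↦ g_w(x) ⊗ w y` with `g_w = g_{t₁} ⋯ g_{t_k}`. -/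
def oneTmulMul : FreeAlgebra K X →ₐ[K] Module.End K (FreeAlgebra K X ⊗[K] FreeAlgebra K X) :=
  FreeAlgebra.lift K fun t =>
    TensorProduct.map (χ.act t).toLinearMap (LinearMap.mulLeft K (FreeAlgebra.ι K t))

/-- The multiplication `(μ ⊗ μ) (id ⊗ c ⊗ id)` of the braided tensor product algebra `TV ⊗ TV`,
that is, `(x ⊗ w) (x' ⊗ y') = x g_w(x') ⊗ w y'` for words `w`. Here the braiding `c` of `TV`,
`c(w ⊗ x') = g_w(x') ⊗ w`, extends the braiding `c(e_t ⊗ e_s) = χ(t,s) e_{t ▷ s} ⊗ e_t` of `V`. -/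
def braidedMul : FreeAlgebra K X ⊗[K] FreeAlgebra K X →ₗ[K]
    FreeAlgebra K X ⊗[K] FreeAlgebra K X →ₗ[K] FreeAlgebra K X ⊗[K] FreeAlgebra K X :=
  TensorProduct.lift <|
    (LinearMap.llcomp K (FreeAlgebra K X ⊗[K] FreeAlgebra K X)
      (FreeAlgebra K X ⊗[K] FreeAlgebra K X) (FreeAlgebra K X ⊗[K] FreeAlgebra K X) ∘ₗ
      LinearMap.rTensorHom (FreeAlgebra K X) ∘ₗ LinearMap.mul K (FreeAlgebra K X)).compl₂
    χ.oneTmulMul.toLinearMap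

theorem braidedMul_tmul (x a : FreeAlgebra K X) (z : FreeAlgebra K X ⊗[K] FreeAlgebra K X) :
    χ.braidedMul (x ⊗ₜ a) z =
      (LinearMap.mulLeft K x).rTensor (FreeAlgebra K X) (χ.oneTmulMul a z) := rfl

theorem oneTmulMul_ι (t : X) (x y : FreeAlgebra K X) :
    χ.oneTmulMul (FreeAlgebra.ι K t) (x ⊗ₜ y) = χ.act t x ⊗ₜ (FreeAlgebra.ι K t * y) := by
  simp [oneTmulMul]

/-- Left multiplication by `Δ(a)` on the braided tensor product algebra; it is multiplicative in
`a`, and for `a = e_t` it is left multiplication by `e_t ⊗ 1 + 1 ⊗ e_t`. -/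
def comulMul : FreeAlgebra K X →ₐ[K] Module.End K (FreeAlgebra K X ⊗[K] FreeAlgebra K X) :=
  FreeAlgebra.lift K fun t : X => χ.braidedMul (FreeAlgebra.ι K t ⊗ₜ 1 + 1 ⊗ₜ FreeAlgebra.ι K t)

/-- The braided comultiplication of `TV`: the linear map with `Δ(1) = 1 ⊗ 1` and
`Δ(e_t a) = (e_t ⊗ 1 + 1 ⊗ e_t) Δ(a)` in the braided tensor product algebra. It is the only
unital multiplicative map to that algebra for which the `e_t` are primitive, see `comul_one`,
`comul_ι` and `comul_mul`. -/
def comul : FreeAlgebra K X →ₗ[K] FreeAlgebra K X ⊗[K] FreeAlgebra K X :=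
  LinearMap.applyₗ ((1 : FreeAlgebra K X) ⊗ₜ[K] (1 : FreeAlgebra K X)) ∘ₗ χ.comulMul.toLinearMap

theorem comul_apply (a : FreeAlgebra K X) : χ.comul a = χ.comulMul a (1 ⊗ₜ 1) := rfl

theorem comul_one : χ.comul 1 = 1 ⊗ₜ 1 := by
  rw [comul_apply, map_one, Module.End.one_apply]

theorem comul_ι (t : X) :
    χ.comul (FreeAlgebra.ι K t) = FreeAlgebra.ι K t ⊗ₜ 1 + 1 ⊗ₜ FreeAlgebra.ι K t := by
  simp [comul_apply, comulMul, braidedMul_tmul, oneTmulMul_ι]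

theorem braidedMul_ι_assoc (t : X) (y z : FreeAlgebra K X ⊗[K] FreeAlgebra K X) :
    χ.braidedMul (χ.braidedMul (FreeAlgebra.ι K t ⊗ₜ 1 + 1 ⊗ₜ FreeAlgebra.ι K t) y) z =
      χ.braidedMul (FreeAlgebra.ι K t ⊗ₜ 1 + 1 ⊗ₜ FreeAlgebra.ι K t) (χ.braidedMul y z) := by
  induction y with
  | zero => simp
  | add u v hu hv => simp only [map_add, LinearMap.add_apply] at hu hv ⊢; rw [hu, hv]
  | tmul a b =>
    simp only [map_add, LinearMap.add_apply, braidedMul_tmul, oneTmulMul_ι, map_one,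
      Module.End.one_apply, LinearMap.rTensor_tmul, LinearMap.mulLeft_apply, map_mul,
      Module.End.mul_apply, LinearMap.mulLeft_one, LinearMap.rTensor_id, LinearMap.id_apply]
    generalize χ.oneTmulMul b z = w
    induction w with
    | zero => simp
    | add u v hu hv => simp only [map_add] at hu hv ⊢; rw [add_add_add_comm, hu, hv]; abel
    | tmul c d => simp [oneTmulMul_ι]

theorem braidedMul_comulMul (a : FreeAlgebra K X) (y z : FreeAlgebra K X ⊗[K] FreeAlgebra K X) :
    χ.braidedMul (χ.comulMul a y) z = χ.comulMul a (χ.braidedMul y z) := by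
  induction a generalizing y with
  | grade0 r => simp
  | grade1 t => simpa [comulMul] using χ.braidedMul_ι_assoc t y z
  | mul u v hu hv => simp only [map_mul, Module.End.mul_apply, hu, hv]
  | add u v hu hv => simp only [map_add, LinearMap.add_apply, hu, hv]

theorem comul_mul (a b : FreeAlgebra K X) :
    χ.comul (a * b) = χ.braidedMul (χ.comul a) (χ.comul b) := by
  rw [comul_apply, comul_apply, braidedMul_comulMul, map_mul, Module.End.mul_apply,
    braidedMul_tmul, map_one, Module.End.one_apply, LinearMap.mulLeft_one, LinearMap.rTensor_id,
    LinearMap.id_apply, comul_apply]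

/-- The homogeneous component of degree `n` of the tensor algebra, spanned by the words of
length `n`. -/
def tensorDegree (X K : Type*) [Field K] (n : ℕ) : Submodule K (FreeAlgebra K X) :=
  Submodule.span K (Set.range (FreeAlgebra.ι K : X → FreeAlgebra K X)) ^ n

/-- The two-sided ideals of `TV` which are homogeneous, generated in degrees at least two, and
satisfy `Δ(J) ⊆ J ⊗ TV + TV ⊗ J`. -/
structure IsNicholsIdeal (J : Ideal (FreeAlgebra K X)) : Prop where
  isTwoSided : J.IsTwoSided
  /-- Every element of `J` is a sum of homogeneous elements of `J` of degrees at least two. -/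
  homogeneous : J.restrictScalars K ≤ ⨆ n : ℕ, J.restrictScalars K ⊓ tensorDegree X K (n + 2)
  coideal : (J.restrictScalars K).map χ.comul ≤
    LinearMap.range ((J.restrictScalars K).subtype.rTensor (FreeAlgebra K X)) ⊔
      LinearMap.range ((J.restrictScalars K).subtype.lTensor (FreeAlgebra K X))

/-- The largest homogeneous ideal and coideal of `TV` living in degrees at least two. -/
def nicholsIdeal : Ideal (FreeAlgebra K X) := sSup {J | χ.IsNicholsIdeal J}

theorem nicholsIdeal_induction {P : FreeAlgebra K X → Prop}
    (mem : ∀ J, χ.IsNicholsIdeal J → ∀ x ∈ J, P x) (zero : P 0)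
    (add : ∀ x y, P x → P y → P (x + y)) {x : FreeAlgebra K X} (hx : x ∈ χ.nicholsIdeal) :
    P x := by
  rw [nicholsIdeal, sSup_eq_iSup'] at hx
  exact Submodule.iSup_induction _ (motive := P) hx (fun J y hy => mem J J.2 y hy) zero add

instance : χ.nicholsIdeal.IsTwoSided where
  mul_mem_of_left {a} b ha := by
    refine χ.nicholsIdeal_induction (P := fun x => x * b ∈ χ.nicholsIdeal) ?_ ?_ ?_ ha
    · exact fun J hJ x hx => le_sSup (a := J) hJ (hJ.isTwoSided.mul_mem_of_left b hx)
    · simp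
    · intro x y hx hy
      rw [add_mul]
      exact add_mem hx hy

theorem isGreatest_nicholsIdeal : IsGreatest {J | χ.IsNicholsIdeal J} χ.nicholsIdeal := by
  have hle : ∀ J, χ.IsNicholsIdeal J →
      J.restrictScalars K ≤ χ.nicholsIdeal.restrictScalars K :=
    fun J hJ x hx => le_sSup (a := J) hJ hx
  refine ⟨⟨inferInstance, fun x hx => ?_, Submodule.map_le_iff_le_comap.2 fun x hx => ?_⟩,
    fun J hJ => le_sSup hJ⟩
  · refine χ.nicholsIdeal_induction (fun J hJ y hy => ?_) (zero_mem _)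
      (fun y z hy hz => add_mem hy hz) hx
    exact iSup_mono (fun n => inf_le_inf_right _ (hle J hJ)) (hJ.homogeneous hy)
  · refine χ.nicholsIdeal_induction (fun J hJ y hy => ?_) (zero_mem _)
      (fun y z hy hz => add_mem hy hz) hx
    have hsup := sup_le_sup
      (LinearMap.range_comp_le_range
        ((Submodule.inclusion (hle J hJ)).rTensor (FreeAlgebra K X))
        ((χ.nicholsIdeal.restrictScalars K).subtype.rTensor (FreeAlgebra K X)))
      (LinearMap.range_comp_le_range
        ((Submodule.inclusion (hle J hJ)).lTensor (FreeAlgebra K X))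
        ((χ.nicholsIdeal.restrictScalars K).subtype.lTensor (FreeAlgebra K X)))
    rw [← LinearMap.rTensor_comp, ← LinearMap.lTensor_comp,
      Submodule.subtype_comp_inclusion] at hsup
    exact hsup (hJ.coideal (Submodule.mem_map_of_mem hy))

/-- The Nichols algebra `TV / I` of the braided vector space `V = K X`. -/
abbrev NicholsAlgebra : Type _ := FreeAlgebra K X ⧸ χ.nicholsIdeal

/-- The generator `e_t` of the Nichols algebra. -/
def gen (t : X) : χ.NicholsAlgebra := Ideal.Quotient.mk χ.nicholsIdeal (FreeAlgebra.ι K t)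

/-- The homogeneous component of degree `n` of the Nichols algebra. -/
def degree (n : ℕ) : Submodule K χ.NicholsAlgebra :=
  (tensorDegree X K n).map (Ideal.Quotient.mkₐ K χ.nicholsIdeal).toLinearMap

/-- The subalgebra (with one) of the Nichols algebra generated by the `e_t` with `t ∈ S`. If `S`
is a subrack, this is the corresponding Nichols subalgebra. -/
def nicholsSubalgebra (S : Set X) : Subalgebra K χ.NicholsAlgebra :=
  Algebra.adjoin K (χ.gen '' S)

/-- The Hilbert series of a graded subspace of the Nichols algebra. -/
def hilbertSeries (W : Submodule K χ.NicholsAlgebra) : PowerSeries ℤ :=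
  PowerSeries.mk fun n => (Module.finrank K ↥(W ⊓ χ.degree n) : ℤ)

end

end RackCocycle

/-! Right and left skew derivations strip a letter from either end of an element of $TV$, by
applying $e_s^*$ to one factor of $\Delta$. The ideal $I$ is exactly the set of elements annihilated
by the counit after every word of right skew derivations (`nicholsIdeal_eq`); the left ones give the
same radical, since the two kinds commute and agree under the counit. Hence both descend to
$\mathfrak B$ and separate its elements.

Let $\mathcal K$ be the common kernel of the right skew derivations $\partial_s$, $s\in X'$. Words
in these derivations are linear over $\mathcal K$ for left multiplication, and their span in length
$j$ is dual to $\mathfrak B'(j)$. Filtering $\mathfrak B$ by the length of the words that kill an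
element gives $\mathcal H_{\mathfrak B}=\mathcal H_{\mathfrak B'}\mathcal H_{\mathcal K}$
(`hilbertSeries_eq_mul`), the numerical form of $\mathfrak B\cong\mathcal K\otimes\mathfrak B'$.

It remains to extract $(m)_t$ from $\mathcal H_{\mathcal K}$. Take $t\notin X'$ and $q=\chi(t,t)$.
Left multiplication by $e_t$ and all left skew derivations preserve $\mathcal K$. If
$t\triangleright t=t$, they satisfy $DE=1+qED$, and a finite-dimensional graded module over this
quantum Weyl algebra has Hilbert series divisible by $(m)_t$ (`exists_finrank_eq_geom_sum_mul`): $D$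
identifies consecutive layers of the filtration by $\ker D^i$, except where $m$ divides the index.

In a rack $t\triangleright t$ may differ from $t$. Then $t$ is replaced by the set $O$ of all
elements outside $X'$ which act like $t$, have the same cocycle row and the same diagonal value. The
operators live on $\mathcal K^O$, so $(m)_t$ divides $|O|\,\mathcal H_{\mathcal K}$; as $(m)_t$ is
monic, the factor $|O|$ cancels over $\mathbb Z$. -/

namespace RackCocycle

/-! ### Skew derivations of the tensor algebra -/

noncomputable section

open FreeAlgebra

theorem linearMap_ext_left {X K M : Type*} [Field K] [AddCommGroup M] [Module K M]
    {f g : FreeAlgebra K X →ₗ[K] M} (one : f 1 = g 1)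
    (mul : ∀ t a, f a = g a → f (ι K t * a) = g (ι K t * a)) : f = g := by
  -- Quantifying over the right factor `b` lets the product case apply the two induction hypotheses
  -- one after the other.
  have key : ∀ a b, f b = g b → f (a * b) = g (a * b) := by
    intro a
    induction a with
    | grade0 r => intro b hb; simp [← Algebra.smul_def, hb]
    | grade1 t => exact fun b hb => mul t b hb
    | mul u v hu hv => intro b hb; rw [mul_assoc]; exact hu _ (hv b hb)
    | add u v hu hv => intro b hb; rw [add_mul, map_add, map_add, hu b hb, hv b hb]
  ext a
  simpa using key a 1 one

theorem algebraMapInv_ι {X K : Type*} [Field K] (t : X) : algebraMapInv (ι K t) = 0 := by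
  simp [algebraMapInv]

section Coefficient

variable {X K : Type*} [Field K] [DecidableEq X]

/-- The coefficient of the word `e_s` of length one. -/
def linCoeff (s : X) : FreeAlgebra K X →ₗ[K] K :=
  TrivSqZeroExt.sndHom K K ∘ₗ
    (FreeAlgebra.lift K fun t => if t = s then (DualNumber.eps : DualNumber K) else 0).toLinearMap

theorem linCoeff_one (s : X) : linCoeff s (1 : FreeAlgebra K X) = 0 := by
  simp [linCoeff]

theorem linCoeff_mul (s : X) (a b : FreeAlgebra K X) :
    linCoeff s (a * b) = algebraMapInv a * linCoeff s b + algebraMapInv b * linCoeff s a := by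
  have h : (TrivSqZeroExt.fstHom K K K).comp
      (FreeAlgebra.lift K fun t => if t = s then (DualNumber.eps : DualNumber K) else 0) =
      algebraMapInv := by
    ext t
    by_cases hts : t = s <;> simp [hts, algebraMapInv_ι]
  have h' (x : FreeAlgebra K X) := DFunLike.congr_fun h x
  simp only [AlgHom.comp_apply, TrivSqZeroExt.fstHom_apply] at h'
  simp [linCoeff, TrivSqZeroExt.snd_mul, h', mul_comm]

theorem linCoeff_ι (s t : X) : linCoeff s (ι K t) = if t = s then 1 else 0 := by
  by_cases hts : t = s <;> simp [linCoeff, hts]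

theorem linCoeff_ι_mul (s t : X) (a : FreeAlgebra K X) :
    linCoeff s (ι K t * a) = if t = s then algebraMapInv a else 0 := by
  simp [linCoeff_mul, algebraMapInv_ι, linCoeff_ι]

end Coefficient

variable {X K : Type*} [Rack X] [Field K] (χ : RackCocycle X K)

theorem act_ι (t s : X) : χ.act t (ι K s) = (χ.val t s : K) • ι K (t ◃ s) := by
  simp [act]

theorem algebraMapInv_act (t : X) (a : FreeAlgebra K X) :
    algebraMapInv (χ.act t a) = algebraMapInv a := by
  have : algebraMapInv.comp (χ.act t) = algebraMapInv := by
    ext s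
    simp [act_ι, algebraMapInv_ι]
  exact DFunLike.congr_fun this a

theorem cocycle_coe (t s r : X) :
    (χ.val t (s ◃ r) : K) * χ.val s r = χ.val (t ◃ s) (t ◃ r) * χ.val t r := by
  exact_mod_cast congrArg Units.val (χ.cocycle t s r)

/-- On generators this is the cocycle identity together with self-distributivity; it is what makes
each $g_t$ compatible with the braiding and hence with $\Delta$. -/
theorem act_act (t u : X) (a : FreeAlgebra K X) :
    χ.act (t ◃ u) (χ.act t a) = χ.act t (χ.act u a) := by
  have : (χ.act (t ◃ u)).comp (χ.act t) = (χ.act t).comp (χ.act u) := by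
    ext r
    simp only [AlgHom.comp_apply, Function.comp_apply, act_ι, map_smul, smul_smul]
    rw [mul_comm, ← χ.cocycle_coe, mul_comm, ← Shelf.self_distrib]
  exact DFunLike.congr_fun this a

theorem comul_ι_mul (t : X) (a : FreeAlgebra K X) :
    χ.comul (ι K t * a) =
      TensorProduct.map (LinearMap.mulLeft K (ι K t)) LinearMap.id (χ.comul a) +
        TensorProduct.map (χ.act t).toLinearMap (LinearMap.mulLeft K (ι K t)) (χ.comul a) := by
  rw [comul_mul, comul_ι]
  generalize χ.comul a = z
  induction z with
  | zero => simp
  | add u v hu hv => simp only [map_add, LinearMap.add_apply] at hu hv ⊢; rw [hu, hv]; abel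
  | tmul c d => simp [braidedMul_tmul, oneTmulMul_ι]

theorem comul_act (t : X) (a : FreeAlgebra K X) :
    χ.comul (χ.act t a) =
      TensorProduct.map (χ.act t).toLinearMap (χ.act t).toLinearMap (χ.comul a) := by
  suffices h : χ.comul ∘ₗ (χ.act t).toLinearMap =
      TensorProduct.map (χ.act t).toLinearMap (χ.act t).toLinearMap ∘ₗ χ.comul from
    DFunLike.congr_fun h a
  refine linearMap_ext_left (by simp [comul_one]) fun u a h => ?_
  simp only [LinearMap.comp_apply, AlgHom.toLinearMap_apply] at h ⊢
  rw [map_mul, act_ι, smul_mul_assoc, map_smul, comul_ι_mul, comul_ι_mul, h]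
  generalize χ.comul a = z
  induction z with
  | zero => simp
  | add x y hx hy =>
    simp only [map_add, smul_add] at hx hy ⊢
    rw [add_add_add_comm, hx, hy]; abel
  | tmul c d => simp [act_ι, act_act, TensorProduct.smul_tmul']

theorem algebraMapInv_rTensor_comul (a : FreeAlgebra K X) :
    TensorProduct.lid K _ ((algebraMapInv.toLinearMap).rTensor _ (χ.comul a)) = a := by
  suffices h : (TensorProduct.lid K _).toLinearMap ∘ₗ
      (algebraMapInv.toLinearMap).rTensor _ ∘ₗ χ.comul = LinearMap.id from DFunLike.congr_fun h a
  refine linearMap_ext_left (by simp [comul_one]) fun u a h => ?_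
  simp only [LinearMap.comp_apply, LinearEquiv.coe_coe, LinearMap.id_apply, comul_ι_mul] at h ⊢
  nth_rw 3 [← h]
  generalize χ.comul a = z
  induction z with
  | zero => simp
  | add x y hx hy =>
    simp only [map_add, mul_add] at hx hy ⊢
    rw [add_add_add_comm, hx, hy]
  | tmul c d => simp [algebraMapInv_ι, algebraMapInv_act]

theorem algebraMapInv_lTensor_comul (a : FreeAlgebra K X) :
    TensorProduct.rid K _ ((algebraMapInv.toLinearMap).lTensor _ (χ.comul a)) = a := by
  suffices h : (TensorProduct.rid K _).toLinearMap ∘ₗ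
      (algebraMapInv.toLinearMap).lTensor _ ∘ₗ χ.comul = LinearMap.id from DFunLike.congr_fun h a
  refine linearMap_ext_left (by simp [comul_one]) fun u a h => ?_
  simp only [LinearMap.comp_apply, LinearEquiv.coe_coe, LinearMap.id_apply, comul_ι_mul] at h ⊢
  nth_rw 3 [← h]
  generalize χ.comul a = z
  induction z with
  | zero => simp
  | add x y hx hy =>
    simp only [map_add, mul_add] at hx hy ⊢
    rw [add_add_add_comm, hx, hy]
  | tmul c d => simp [algebraMapInv_ι]

variable [DecidableEq X]

/-- The right skew derivation `(id ⊗ e_s^*) Δ` of the tensor algebra. -/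
def derR (s : X) : FreeAlgebra K X →ₗ[K] FreeAlgebra K X :=
  (TensorProduct.rid K _).toLinearMap ∘ₗ (linCoeff s).lTensor _ ∘ₗ χ.comul

/-- The left skew derivation `(e_s^* ⊗ id) Δ` of the tensor algebra. -/
def derL (s : X) : FreeAlgebra K X →ₗ[K] FreeAlgebra K X :=
  (TensorProduct.lid K _).toLinearMap ∘ₗ (linCoeff s).rTensor _ ∘ₗ χ.comul

theorem derR_one (s : X) : χ.derR s 1 = 0 := by
  simp [derR, comul_one, linCoeff_one]

theorem derL_one (s : X) : χ.derL s 1 = 0 := by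
  simp [derL, comul_one, linCoeff_one]

theorem linCoeff_act {t s r : X} (hr : t ◃ s = r) (a : FreeAlgebra K X) :
    linCoeff r (χ.act t a) = χ.val t s * linCoeff s a := by
  suffices h : linCoeff r ∘ₗ (χ.act t).toLinearMap = (χ.val t s : K) • linCoeff s from
    DFunLike.congr_fun h a
  refine linearMap_ext_left (by simp [linCoeff_one]) fun u a _ => ?_
  have hus : t ◃ u = r ↔ u = s := by rw [← hr]; exact (Rack.act' t).injective.eq_iff
  rw [LinearMap.comp_apply, AlgHom.toLinearMap_apply, map_mul, act_ι, smul_mul_assoc,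
    map_smul, linCoeff_ι_mul, algebraMapInv_act, LinearMap.smul_apply, linCoeff_ι_mul]
  by_cases h : u = s
  · rw [if_pos (hus.2 h), if_pos h, h]
  · rw [if_neg (mt hus.1 h), if_neg h, smul_zero, smul_zero]

theorem derR_ι_mul (s t : X) (a : FreeAlgebra K X) :
    χ.derR s (ι K t * a) = ι K t * χ.derR s a + if t = s then χ.act s a else 0 := by
  have h := χ.algebraMapInv_lTensor_comul a
  have : (if t = s then χ.act s a else 0) = if t = s then χ.act s
      (TensorProduct.rid K _ ((algebraMapInv.toLinearMap).lTensor _ (χ.comul a))) else 0 := by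
    rw [h]
  rw [this]
  simp only [derR, LinearMap.comp_apply, comul_ι_mul]
  generalize χ.comul a = z
  induction z with
  | zero => simp
  | add x y hx hy =>
    simp only [map_add, mul_add] at hx hy ⊢
    rw [add_add_add_comm, hx, hy]
    split_ifs <;> abel
  | tmul c d => by_cases hts : t = s <;> simp [linCoeff_ι_mul, hts]

/-- The term $1\otimes e_t$ of $\Delta(e_t)$ acts by $g_t$ on the left factor, and
$e_{t\triangleright s}^*\circ g_t=\chi(t,s)\,e_s^*$. So the index of the derivation changes when it
passes $e_t$, unlike for `derR`. -/
theorem derL_ι_mul {t s r : X} (hr : t ◃ s = r) (a : FreeAlgebra K X) :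
    χ.derL r (ι K t * a) =
      (if t = r then a else 0) + (χ.val t s : K) • (ι K t * χ.derL s a) := by
  have h := χ.algebraMapInv_rTensor_comul a
  have : (if t = r then a else 0) = if t = r then
      (TensorProduct.lid K _ ((algebraMapInv.toLinearMap).rTensor _ (χ.comul a))) else 0 := by
    rw [h]
  rw [this]
  simp only [derL, LinearMap.comp_apply, comul_ι_mul]
  generalize χ.comul a = z
  induction z with
  | zero => simp
  | add x y hx hy =>
    simp only [map_add, mul_add, smul_add] at hx hy ⊢
    rw [add_add_add_comm, hx, hy]
    split_ifs <;> abel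
  | tmul c d =>
    by_cases hts : t = r
    · simp [linCoeff_ι_mul, χ.linCoeff_act hr, if_pos hts, smul_smul]
    · simp [linCoeff_ι_mul, χ.linCoeff_act hr, if_neg hts, smul_smul]

theorem derR_act {t s r : X} (hr : t ◃ s = r) (a : FreeAlgebra K X) :
    χ.derR r (χ.act t a) = (χ.val t s : K) • χ.act t (χ.derR s a) := by
  suffices h : χ.derR r ∘ₗ (χ.act t).toLinearMap =
      (χ.val t s : K) • ((χ.act t).toLinearMap ∘ₗ χ.derR s) from DFunLike.congr_fun h a
  refine linearMap_ext_left (by simp [derR_one]) fun u a h => ?_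
  simp only [LinearMap.comp_apply, AlgHom.toLinearMap_apply, LinearMap.smul_apply] at h ⊢
  have hus : t ◃ u = r ↔ u = s := by rw [← hr]; exact (Rack.act' t).injective.eq_iff
  rw [map_mul, act_ι, smul_mul_assoc, map_smul, derR_ι_mul, derR_ι_mul, h]
  by_cases hu : u = s
  · rw [if_pos (hus.2 hu), if_pos hu, ← hr, ← hu, act_act, map_add, map_mul, act_ι, smul_add,
      smul_add, mul_smul_comm, smul_mul_assoc, smul_comm (χ.val t u : K)]
  · rw [if_neg (mt hus.1 hu), if_neg hu, map_add, map_mul, act_ι, map_zero, add_zero, add_zero,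
      mul_smul_comm, smul_mul_assoc, smul_comm (χ.val t u : K)]

theorem derL_act {t s r : X} (hr : t ◃ s = r) (a : FreeAlgebra K X) :
    χ.derL r (χ.act t a) = (χ.val t s : K) • χ.act t (χ.derL s a) := by
  -- Passing a letter changes the index of a left derivation, so the induction must carry all
  -- indices at once.
  let f (x : X) : FreeAlgebra K X →ₗ[K] FreeAlgebra K X :=
    χ.derL (t ◃ x) ∘ₗ (χ.act t).toLinearMap
  let g (x : X) : FreeAlgebra K X →ₗ[K] FreeAlgebra K X :=
    (χ.val t x : K) • ((χ.act t).toLinearMap ∘ₗ χ.derL x)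
  suffices h : LinearMap.pi f = LinearMap.pi g by
    subst hr
    exact congrFun (DFunLike.congr_fun h a) s
  refine linearMap_ext_left (by ext x; simp [f, g, derL_one]) fun u a h => ?_
  ext x
  obtain ⟨y, rfl⟩ := (Rack.act' u).surjective x
  have h' := congrFun h y
  simp only [LinearMap.pi_apply, f, g, LinearMap.comp_apply, AlgHom.toLinearMap_apply,
    LinearMap.smul_apply, Rack.act'_apply] at h' ⊢
  have hu : t ◃ u = t ◃ (u ◃ y) ↔ u = u ◃ y := (Rack.act' t).injective.eq_iff
  rw [map_mul, act_ι, smul_mul_assoc, map_smul, χ.derL_ι_mul (Shelf.self_distrib (x := t)).symm,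
    χ.derL_ι_mul rfl, h']
  have hc := χ.cocycle_coe t u y
  simp only [hu, smul_add, map_add, map_smul, map_mul, act_ι, mul_smul_comm, smul_mul_assoc,
    smul_smul]
  congr 1
  · split_ifs with h1
    · rw [← h1]
    · simp
  · rw [← hc]
    ring_nf

theorem algebraMapInv_derR (s : X) (a : FreeAlgebra K X) :
    algebraMapInv (χ.derR s a) = linCoeff s a := by
  suffices h : algebraMapInv.toLinearMap ∘ₗ χ.derR s = linCoeff s from DFunLike.congr_fun h a
  refine linearMap_ext_left (by simp [derR_one, linCoeff_one]) fun u a _ => ?_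
  by_cases hus : u = s <;>
    simp [derR_ι_mul, linCoeff_ι_mul, algebraMapInv_ι, hus, algebraMapInv_act]

theorem algebraMapInv_derL (s : X) (a : FreeAlgebra K X) :
    algebraMapInv (χ.derL s a) = linCoeff s a := by
  suffices h : algebraMapInv.toLinearMap ∘ₗ χ.derL s = linCoeff s from DFunLike.congr_fun h a
  refine linearMap_ext_left (by simp [derL_one, linCoeff_one]) fun u a _ => ?_
  obtain ⟨y, hy⟩ := (Rack.act' u).surjective s
  rw [LinearMap.comp_apply, χ.derL_ι_mul hy, linCoeff_ι_mul]
  split_ifs <;> simp [algebraMapInv_ι]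

theorem derR_mul (s : X) (a b : FreeAlgebra K X) :
    χ.derR s (a * b) = a * χ.derR s b + χ.derR s a * χ.act s b := by
  let f := χ.derR s ∘ₗ LinearMap.mulRight K b
  let g := LinearMap.mulRight K (χ.derR s b) +
    LinearMap.mulRight K (χ.act s b) ∘ₗ χ.derR s
  suffices h : f = g from DFunLike.congr_fun h a
  refine linearMap_ext_left (by simp [f, g, derR_one]) fun u a h => ?_
  simp only [f, g, LinearMap.comp_apply, LinearMap.add_apply, LinearMap.mulRight_apply] at h ⊢
  rw [mul_assoc, derR_ι_mul, derR_ι_mul, h]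
  split_ifs <;> simp [mul_add, add_mul, mul_assoc, add_assoc]

/-- A trace of coassociativity: the two derivations act at opposite ends. -/
theorem derL_derR (r s : X) (a : FreeAlgebra K X) :
    χ.derL r (χ.derR s a) = χ.derR s (χ.derL r a) := by
  let f (r : X) : FreeAlgebra K X →ₗ[K] FreeAlgebra K X := χ.derL r ∘ₗ χ.derR s
  let g (r : X) : FreeAlgebra K X →ₗ[K] FreeAlgebra K X := χ.derR s ∘ₗ χ.derL r
  suffices h : LinearMap.pi f = LinearMap.pi g from congrFun (DFunLike.congr_fun h a) r
  refine linearMap_ext_left (by ext x; simp [f, g, derR_one, derL_one]) fun t a h => ?_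
  ext r
  obtain ⟨y, hy⟩ := (Rack.act' t).surjective r
  have h' := congrFun h y
  simp only [LinearMap.pi_apply, f, g, LinearMap.comp_apply] at h' ⊢
  rw [derR_ι_mul, map_add, χ.derL_ι_mul hy, χ.derL_ι_mul hy, map_add, map_smul, derR_ι_mul, h']
  by_cases hts : t = s
  · subst hts
    rw [if_pos rfl, if_pos rfl, χ.derL_act hy]
    split_ifs <;> simp [add_assoc]
  · rw [if_neg hts, if_neg hts]
    split_ifs <;> simp

theorem comul_derR (s : X) (a : FreeAlgebra K X) :
    χ.comul (χ.derR s a) = (χ.derR s).lTensor _ (χ.comul a) := by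
  suffices h : χ.comul ∘ₗ χ.derR s = (χ.derR s).lTensor _ ∘ₗ χ.comul from DFunLike.congr_fun h a
  refine linearMap_ext_left (by simp [derR_one, comul_one]) fun t a h => ?_
  simp only [LinearMap.comp_apply] at h ⊢
  have h2 : χ.comul (if t = s then χ.act s a else 0) = if t = s then
      TensorProduct.map (χ.act s).toLinearMap (χ.act s).toLinearMap (χ.comul a) else 0 := by
    split_ifs
    · exact χ.comul_act s a
    · exact map_zero _
  rw [derR_ι_mul, map_add, h2, comul_ι_mul, comul_ι_mul, h]
  generalize χ.comul a = z
  induction z with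
  | zero => simp
  | add x y hx hy =>
    simp only [map_add] at hx hy ⊢
    split_ifs at hx hy ⊢ <;> linear_combination (norm := abel) hx + hy
  | tmul c d =>
    by_cases hts : t = s <;> simp [derR_ι_mul, hts, TensorProduct.tmul_add, add_assoc]

theorem comul_derL (r : X) (a : FreeAlgebra K X) :
    χ.comul (χ.derL r a) = (χ.derL r).rTensor _ (χ.comul a) := by
  let f (r : X) := χ.comul ∘ₗ χ.derL r
  let g (r : X) := (χ.derL r).rTensor _ ∘ₗ χ.comul
  suffices h : LinearMap.pi f = LinearMap.pi g from congrFun (DFunLike.congr_fun h a) r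
  refine linearMap_ext_left (by ext x; simp [f, g, comul_one, derL_one]) fun t a h => ?_
  ext r
  obtain ⟨y, hy⟩ := (Rack.act' t).surjective r
  have h' := congrFun h y
  simp only [LinearMap.pi_apply, f, g, LinearMap.comp_apply] at h' ⊢
  rw [χ.derL_ι_mul hy, map_add, map_smul, apply_ite χ.comul, map_zero, comul_ι_mul, comul_ι_mul,
    h']
  generalize χ.comul a = z
  induction z with
  | zero => simp
  | add x y hx hy =>
    simp only [map_add, smul_add] at hx hy ⊢
    split_ifs at hx hy ⊢ <;> linear_combination (norm := abel) hx + hy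
  | tmul c d =>
    by_cases hts : t = r
    · simp [χ.derL_ι_mul hy, χ.derL_act hy, if_pos hts, TensorProduct.add_tmul,
        TensorProduct.smul_tmul', add_assoc]
    · simp [χ.derL_ι_mul hy, χ.derL_act hy, if_neg hts, TensorProduct.smul_tmul']

end

/-! ### The grading and the pairing with words of skew derivations -/

noncomputable section

open FreeAlgebra

theorem isSubrack_univ {X : Type*} [Rack X] : IsSubrack (Set.univ : Set X) := fun t _ =>
  Set.bijOn_univ.2 (Rack.act' t).bijective

section TensorDegree

variable {X K : Type*} [Field K]

theorem tensorDegree_induction {p : ℕ → FreeAlgebra K X → Prop}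
    (zero : ∀ n, p n 0) (add : ∀ n a b, p n a → p n b → p n (a + b))
    (smul : ∀ n (c : K) a, p n a → p n (c • a)) (one : p 0 1)
    (mul : ∀ n t a, a ∈ tensorDegree X K n → p n a → p (n + 1) (ι K t * a))
    {n : ℕ} {a : FreeAlgebra K X} (ha : a ∈ tensorDegree X K n) : p n a := by
  induction n generalizing a with
  | zero =>
    obtain ⟨c, rfl⟩ := Submodule.mem_one.1 (by simpa [tensorDegree] using ha)
    rw [Algebra.algebraMap_eq_smul_one]
    exact smul _ _ _ one
  | succ n ih =>
    rw [tensorDegree, pow_succ'] at ha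
    induction ha using Submodule.mul_induction_on' with
    | mem_mul_mem u hu v hv =>
      induction hu using Submodule.span_induction with
      | mem x hx => obtain ⟨t, rfl⟩ := hx; exact mul n t v hv (ih hv)
      | zero => simpa using zero _
      | add x y _ _ hx hy => rw [add_mul]; exact add _ _ _ hx hy
      | smul c x _ hx => rw [smul_mul_assoc]; exact smul _ _ _ hx
    | add x _ y _ hx hy => exact add _ _ _ hx hy

theorem one_mem_tensorDegree : (1 : FreeAlgebra K X) ∈ tensorDegree X K 0 := by
  simp [tensorDegree]

theorem ι_mul_mem_tensorDegree (t : X) {n : ℕ} {a : FreeAlgebra K X}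
    (ha : a ∈ tensorDegree X K n) : ι K t * a ∈ tensorDegree X K (n + 1) := by
  rw [tensorDegree, pow_succ']
  exact Submodule.mul_mem_mul (Submodule.subset_span ⟨t, rfl⟩) ha

theorem ι_mem_tensorDegree (t : X) : ι K t ∈ tensorDegree X K 1 := by
  simpa using ι_mul_mem_tensorDegree t (one_mem_tensorDegree (K := K))

theorem algebraMapInv_eq_zero_of_tensorDegree {n : ℕ} (hn : n ≠ 0) {a : FreeAlgebra K X}
    (ha : a ∈ tensorDegree X K n) : algebraMapInv a = 0 := by
  refine tensorDegree_induction (p := fun n a => n ≠ 0 → algebraMapInv a = 0) (by simp)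
    (fun n a b ha hb h => by simp [ha h, hb h]) (fun n c a ha h => by simp [ha h]) (by simp)
    (fun n u a _ _ _ => by simp [algebraMapInv_ι]) ha hn

theorem iSup_tensorDegree : ⨆ n, tensorDegree X K n = ⊤ := by
  refine eq_top_iff.2 fun a _ => ?_
  have key : ∀ a b : FreeAlgebra K X, b ∈ ⨆ n, tensorDegree X K n →
      a * b ∈ ⨆ n, tensorDegree X K n := by
    intro a
    induction a with
    | grade0 r => intro b hb; rw [← Algebra.smul_def]; exact Submodule.smul_mem _ _ hb
    | grade1 t =>
      intro b hb
      refine Submodule.iSup_induction _ (motive := fun b => ι K t * b ∈ ⨆ n, tensorDegree X K n)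
        hb (fun n x hx => ?_) (by simp) fun x y hx hy => ?_
      · exact Submodule.mem_iSup_of_mem (n + 1) (ι_mul_mem_tensorDegree t hx)
      · rw [mul_add]; exact add_mem hx hy
    | mul u v hu hv => intro b hb; rw [mul_assoc]; exact hu _ (hv b hb)
    | add u v hu hv => intro b hb; rw [add_mul]; exact add_mem (hu b hb) (hv b hb)
  simpa using key a 1 (Submodule.mem_iSup_of_mem 0 one_mem_tensorDegree)

theorem exists_sum_tensorDegree (a : FreeAlgebra K X) :
    ∃ (s : Finset ℕ) (f : ℕ → FreeAlgebra K X), (∀ n, f n ∈ tensorDegree X K n) ∧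
      a = ∑ n ∈ s, f n := by
  have h : a ∈ ⨆ n, tensorDegree X K n := by rw [iSup_tensorDegree]; trivial
  obtain ⟨f, hf⟩ := (Submodule.mem_iSup_iff_exists_finsupp _ a).1 h
  exact ⟨f.support, f, hf.1, hf.2.symm⟩

theorem eq_zero_of_tensorDegree_zero {a : FreeAlgebra K X}
    (h0 : a ∈ tensorDegree X K 0) (ha : algebraMapInv a = 0) : a = 0 := by
  obtain ⟨c, rfl⟩ := Submodule.mem_one.1 (by simpa [tensorDegree] using h0)
  rw [AlgHom.commutes] at ha
  simp only [Algebra.algebraMap_self, RingHom.id_apply] at ha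
  rw [ha, map_zero]

theorem eq_zero_of_tensorDegree_one [DecidableEq X] {a : FreeAlgebra K X}
    (h0 : a ∈ tensorDegree X K 1) (ha : ∀ s, linCoeff s a = 0) : a = 0 := by
  rw [tensorDegree, pow_one, ← Set.image_univ, Finsupp.mem_span_image_iff_linearCombination] at h0
  obtain ⟨c, -, rfl⟩ := h0
  have : c = 0 := by
    ext s
    have := ha s
    simpa [Finsupp.linearCombination_apply, Finsupp.sum, linCoeff_ι] using this
  simp [this]

theorem linCoeff_eq_zero_of_tensorDegree [DecidableEq X] (s : X) {n : ℕ} {a : FreeAlgebra K X}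
    (ha : a ∈ tensorDegree X K (n + 2)) : linCoeff s a = 0 := by
  refine tensorDegree_induction (p := fun n a => 2 ≤ n → linCoeff s a = 0) (by simp)
    (fun n a b ha hb h => by simp [ha h, hb h]) (fun n c a ha h => by simp [ha h]) (by simp)
    (fun n u a ha _ h => ?_) ha (by simp)
  rw [linCoeff_ι_mul, algebraMapInv_eq_zero_of_tensorDegree (by lia) ha, ite_self]

end TensorDegree

variable {X K : Type*} [Rack X] [Field K] (χ : RackCocycle X K)

theorem act_mem_tensorDegree {χ : RackCocycle X K} (t : X) {n : ℕ} {a : FreeAlgebra K X}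
    (ha : a ∈ tensorDegree X K n) : χ.act t a ∈ tensorDegree X K n := by
  refine tensorDegree_induction (p := fun n a => χ.act t a ∈ tensorDegree X K n)
    (by simp) (fun n a b ha hb => ?_) (fun n c a ha => ?_) ?_ (fun n u a _ ha => ?_) ha
  · rw [map_add]; exact add_mem ha hb
  · rw [map_smul]; exact Submodule.smul_mem _ _ ha
  · rw [map_one]; exact one_mem_tensorDegree
  · rw [map_mul, act_ι, smul_mul_assoc]
    exact Submodule.smul_mem _ _ (ι_mul_mem_tensorDegree _ ha)

variable [DecidableEq X]

/-- The composition of right skew derivations along a word; the first letter acts first. -/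
def iterR : List X → FreeAlgebra K X →ₗ[K] FreeAlgebra K X
  | [] => LinearMap.id
  | s :: l => iterR l ∘ₗ χ.derR s

/-- The composition of left skew derivations along a word; the first letter acts first. -/
def iterL : List X → FreeAlgebra K X →ₗ[K] FreeAlgebra K X
  | [] => LinearMap.id
  | s :: l => iterL l ∘ₗ χ.derL s

theorem iterR_append (l l' : List X) (a : FreeAlgebra K X) :
    χ.iterR (l ++ l') a = χ.iterR l' (χ.iterR l a) := by
  induction l generalizing a with
  | nil => rfl
  | cons s l ih => exact ih _

theorem iterL_append (l l' : List X) (a : FreeAlgebra K X) :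
    χ.iterL (l ++ l') a = χ.iterL l' (χ.iterL l a) := by
  induction l generalizing a with
  | nil => rfl
  | cons s l ih => exact ih _

theorem derL_iterR (r : X) (l : List X) (a : FreeAlgebra K X) :
    χ.derL r (χ.iterR l a) = χ.iterR l (χ.derL r a) := by
  induction l generalizing a with
  | nil => rfl
  | cons s l ih => exact (ih _).trans (congrArg _ (χ.derL_derR r s a))

theorem derR_iterL (s : X) (l : List X) (a : FreeAlgebra K X) :
    χ.derR s (χ.iterL l a) = χ.iterL l (χ.derR s a) := by
  induction l generalizing a with
  | nil => rfl
  | cons r l ih => exact (ih _).trans (congrArg _ (χ.derL_derR r s a).symm)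

/-- The derivation applied last may be exchanged for its left analogue, since both have the same
constant term; left and right derivations commute, so this can be repeated, and the word gets
reversed. -/
theorem algebraMapInv_iterR (l : List X) (a : FreeAlgebra K X) :
    algebraMapInv (χ.iterR l a) = algebraMapInv (χ.iterL l.reverse a) := by
  induction l generalizing a with
  | nil => rfl
  | cons s l ih =>
    calc algebraMapInv (χ.iterR l (χ.derR s a))
        = algebraMapInv (χ.iterL l.reverse (χ.derR s a)) := ih _
      _ = algebraMapInv (χ.derL s (χ.iterL l.reverse a)) := by
        rw [← derR_iterL, algebraMapInv_derR, algebraMapInv_derL]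
      _ = _ := by rw [List.reverse_cons, iterL_append]; rfl

/-- The elements of the tensor algebra which pair to zero with all words in the right skew
derivations belonging to `S`. -/
def pairingKer (S : Set X) : Submodule K (FreeAlgebra K X) where
  carrier := {a | ∀ l : List X, (∀ s ∈ l, s ∈ S) → algebraMapInv (χ.iterR l a) = 0}
  zero_mem' := fun l _ => by simp
  add_mem' := fun ha hb l hl => by simp [ha l hl, hb l hl]
  smul_mem' := fun c a ha l hl => by simp [ha l hl]

variable {χ} {S : Set X}

theorem algebraMapInv_eq_zero {a : FreeAlgebra K X} (ha : a ∈ χ.pairingKer S) :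
    algebraMapInv a = 0 := ha [] (by simp)

theorem derR_mem_pairingKer {s : X} (hs : s ∈ S) {a : FreeAlgebra K X}
    (ha : a ∈ χ.pairingKer S) : χ.derR s a ∈ χ.pairingKer S := fun l hl =>
  ha (s :: l) (by simpa [hs] using hl)

theorem mem_pairingKer_iff {a : FreeAlgebra K X} : a ∈ χ.pairingKer S ↔
    algebraMapInv a = 0 ∧ ∀ s ∈ S, χ.derR s a ∈ χ.pairingKer S := by
  refine ⟨fun h => ⟨algebraMapInv_eq_zero h, fun s hs => derR_mem_pairingKer hs h⟩,
    fun h l hl => ?_⟩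
  cases l with
  | nil => exact h.1
  | cons s l => exact h.2 s (hl s (by simp)) l fun r hr => hl r (by simp [hr])

theorem act_mem_pairingKer (hS : IsSubrack S) {t : X} (ht : t ∈ S) {a : FreeAlgebra K X}
    (ha : a ∈ χ.pairingKer S) : χ.act t a ∈ χ.pairingKer S := by
  intro l hl
  induction l generalizing a with
  | nil => exact (χ.algebraMapInv_act t a).trans (algebraMapInv_eq_zero ha)
  | cons r l ih =>
    obtain ⟨s, hs, hsr⟩ := (hS t ht).surjOn (hl r (by simp))
    change algebraMapInv (χ.iterR l (χ.derR r (χ.act t a))) = 0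
    rw [χ.derR_act hsr, map_smul, map_smul, ih (derR_mem_pairingKer hs ha)
      fun u hu => hl u (by simp [hu]), smul_zero]

/-- The Leibniz rule twists the right factor by $g_s$, so the kernel must be stable under $g_s$ for
$s\in S$; this is where `S` has to be a subrack. Multiplication on the other side needs no such
condition. -/
theorem mul_mem_pairingKer (hS : IsSubrack S) (a : FreeAlgebra K X) {b : FreeAlgebra K X}
    (hb : b ∈ χ.pairingKer S) : a * b ∈ χ.pairingKer S := by
  intro l hl
  induction l generalizing a b with
  | nil => simp [iterR, algebraMapInv_eq_zero hb]
  | cons s l ih =>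
    have hs : s ∈ S := hl s (by simp)
    have hl' : ∀ r ∈ l, r ∈ S := fun r hr => hl r (by simp [hr])
    change algebraMapInv (χ.iterR l (χ.derR s (a * b))) = 0
    rw [derR_mul, map_add, map_add, ih _ (derR_mem_pairingKer hs hb) hl',
      ih _ (act_mem_pairingKer hS hs hb) hl', add_zero]

theorem mul_mem_pairingKer_of_left {a : FreeAlgebra K X} (b : FreeAlgebra K X)
    (ha : a ∈ χ.pairingKer S) : a * b ∈ χ.pairingKer S := by
  intro l hl
  induction l generalizing a b with
  | nil => simp [iterR, algebraMapInv_eq_zero ha]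
  | cons s l ih =>
    have hs : s ∈ S := hl s (by simp)
    have hl' : ∀ r ∈ l, r ∈ S := fun r hr => hl r (by simp [hr])
    change algebraMapInv (χ.iterR l (χ.derR s (a * b))) = 0
    rw [derR_mul, map_add, map_add, ih _ ha hl', ih _ (derR_mem_pairingKer hs ha) hl', add_zero]

theorem ι_mem_pairingKer {t : X} (ht : t ∉ S) : ι K t ∈ χ.pairingKer S := by
  refine mem_pairingKer_iff.2 ⟨algebraMapInv_ι t, fun s hs => ?_⟩
  have h := χ.derR_ι_mul s t 1
  rw [mul_one, derR_one, mul_zero, zero_add, if_neg (fun h : t = s => ht (h ▸ hs))] at h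
  rw [h]
  exact zero_mem _

theorem derL_mem_pairingKer_univ (s : X) {a : FreeAlgebra K X}
    (ha : a ∈ χ.pairingKer Set.univ) : χ.derL s a ∈ χ.pairingKer Set.univ := by
  intro l _
  rw [← derL_iterR, algebraMapInv_derL, ← χ.algebraMapInv_derR]
  have h := ha (l ++ [s]) (by simp)
  rwa [iterR_append] at h

/-- The first clause compensates for the truncated subtraction `0 - 1 = 0`. -/
theorem derR_tensorDegree (s : X) {n : ℕ} {a : FreeAlgebra K X} (ha : a ∈ tensorDegree X K n) :
    (n = 0 → χ.derR s a = 0) ∧ χ.derR s a ∈ tensorDegree X K (n - 1) := by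
  refine tensorDegree_induction (p := fun n a => (n = 0 → χ.derR s a = 0) ∧
    χ.derR s a ∈ tensorDegree X K (n - 1))
    (by simp) (fun n a b ha hb => ?_) (fun n c a ha => ?_) ?_ (fun n u a h ha => ?_) ha
  · rw [map_add]; exact ⟨fun h => by rw [ha.1 h, hb.1 h, add_zero], add_mem ha.2 hb.2⟩
  · rw [map_smul]; exact ⟨fun h => by rw [ha.1 h, smul_zero], Submodule.smul_mem _ _ ha.2⟩
  · simp [derR_one]
  · rw [derR_ι_mul]
    refine ⟨by simp, add_mem ?_ ?_⟩
    · cases n with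
      | zero => simp [ha.1 rfl]
      | succ n => exact ι_mul_mem_tensorDegree _ ha.2
    · split_ifs
      · exact act_mem_tensorDegree _ h
      · exact zero_mem _

theorem derL_tensorDegree (s : X) {n : ℕ} {a : FreeAlgebra K X} (ha : a ∈ tensorDegree X K n) :
    (n = 0 → χ.derL s a = 0) ∧ χ.derL s a ∈ tensorDegree X K (n - 1) := by
  refine tensorDegree_induction (p := fun n a => ∀ s, (n = 0 → χ.derL s a = 0) ∧
    χ.derL s a ∈ tensorDegree X K (n - 1))
    (by simp) (fun n a b ha hb s => ?_) (fun n c a ha s => ?_) ?_ (fun n u a h ha s => ?_) ha s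
  · rw [map_add]
    exact ⟨fun h => by rw [(ha s).1 h, (hb s).1 h, add_zero], add_mem (ha s).2 (hb s).2⟩
  · rw [map_smul]
    exact ⟨fun h => by rw [(ha s).1 h, smul_zero], Submodule.smul_mem _ _ (ha s).2⟩
  · simp [derL_one]
  · obtain ⟨y, hy⟩ := (Rack.act' u).surjective s
    rw [χ.derL_ι_mul hy]
    refine ⟨by simp, add_mem ?_ (Submodule.smul_mem _ _ ?_)⟩
    · split_ifs
      · exact h
      · exact zero_mem _
    · cases n with
      | zero => simp [(ha y).1 rfl]
      | succ n => exact ι_mul_mem_tensorDegree _ (ha y).2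

theorem algebraMapInv_iterR_of_tensorDegree (l : List X) {n : ℕ} (hn : n ≠ l.length)
    {a : FreeAlgebra K X} (ha : a ∈ tensorDegree X K n) : algebraMapInv (χ.iterR l a) = 0 := by
  induction l generalizing n a with
  | nil => exact algebraMapInv_eq_zero_of_tensorDegree hn ha
  | cons s l ih =>
    change algebraMapInv (χ.iterR l (χ.derR s a)) = 0
    cases n with
    | zero => rw [(derR_tensorDegree s ha).1 rfl, map_zero, map_zero]
    | succ n => exact ih (by simpa using hn) (derR_tensorDegree s ha).2

theorem mem_pairingKer_of_sum {S : Set X} {s : Finset ℕ} {f : ℕ → FreeAlgebra K X}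
    (hf : ∀ n, f n ∈ tensorDegree X K n) (h : ∑ n ∈ s, f n ∈ χ.pairingKer S) {n : ℕ}
    (hn : n ∈ s) : f n ∈ χ.pairingKer S := by
  intro l hl
  by_cases hln : n = l.length
  · have := h l hl
    rwa [map_sum, map_sum, Finset.sum_eq_single n (fun k _ hk =>
      algebraMapInv_iterR_of_tensorDegree l (hln ▸ hk) (hf k)) (fun h => absurd hn h)] at this
  · exact algebraMapInv_iterR_of_tensorDegree l hln (hf n)

end

end RackCocycle

/-- Contracting the left factor with any `f i` gives an element of `N` killed by all `g j`, hence
zero. So the coefficients of `z` in a basis of `N` are killed by all `f i`. -/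
theorem TensorProduct.eq_zero_of_separating {K M N I J : Type*} [Field K] [AddCommGroup M]
    [Module K M] [AddCommGroup N] [Module K N] (f : I → M →ₗ[K] K) (g : J → N →ₗ[K] K)
    (hf : ∀ m, (∀ i, f i m = 0) → m = 0) (hg : ∀ n, (∀ j, g j n = 0) → n = 0)
    (z : M ⊗[K] N) (hz : ∀ i j, TensorProduct.map (f i) (g j) z = 0) : z = 0 := by
  classical
  have h (i) : TensorProduct.lid K N ((f i).rTensor N z) = 0 := by
    refine hg _ fun j => ?_
    have : g j ∘ₗ (TensorProduct.lid K N).toLinearMap ∘ₗ (f i).rTensor N =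
        (TensorProduct.lid K K).toLinearMap ∘ₗ TensorProduct.map (f i) (g j) := by
      ext m n
      simp
    exact (DFunLike.congr_fun this z).trans (by simp [hz])
  let b := Module.Basis.ofVectorSpace K N
  refine (TensorProduct.equivFinsuppOfBasisRight b).map_eq_zero_iff.1 ?_
  ext k
  refine hf _ fun i => ?_
  have : f i ∘ₗ Finsupp.lapply k ∘ₗ (TensorProduct.equivFinsuppOfBasisRight b).toLinearMap =
      b.coord k ∘ₗ (TensorProduct.lid K N).toLinearMap ∘ₗ (f i).rTensor N := by
    ext m n
    simp [mul_comm]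
  exact (DFunLike.congr_fun this z).trans (by simp [h])

namespace RackCocycle

/-! ### The Nichols ideal as the radical of the pairing -/

noncomputable section

open FreeAlgebra

variable {X K : Type*} [Rack X] [Field K] (χ : RackCocycle X K)

theorem map_algebraMapInv_comul (a : FreeAlgebra K X) :
    TensorProduct.lid K K (TensorProduct.map algebraMapInv.toLinearMap algebraMapInv.toLinearMap
      (χ.comul a)) = algebraMapInv a := by
  nth_rw 2 [← χ.algebraMapInv_rTensor_comul a]
  generalize χ.comul a = z
  induction z with
  | zero => simp
  | add x y hx hy => simp only [map_add, hx, hy]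
  | tmul c d => simp

variable [DecidableEq X]

theorem comul_iterR (l : List X) (a : FreeAlgebra K X) :
    χ.comul (χ.iterR l a) = (χ.iterR l).lTensor _ (χ.comul a) := by
  induction l generalizing a with
  | nil => simp [iterR]
  | cons s l ih => simp only [iterR, LinearMap.comp_apply, ih, comul_derR, LinearMap.lTensor_comp]

theorem comul_iterL (l : List X) (a : FreeAlgebra K X) :
    χ.comul (χ.iterL l a) = (χ.iterL l).rTensor _ (χ.comul a) := by
  induction l generalizing a with
  | nil => simp [iterL]
  | cons s l ih => simp only [iterL, LinearMap.comp_apply, ih, comul_derL, LinearMap.rTensor_comp]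

theorem mem_pairingKer_univ {a : FreeAlgebra K X} :
    a ∈ χ.pairingKer Set.univ ↔ ∀ l, algebraMapInv (χ.iterR l a) = 0 :=
  ⟨fun h l => h l (by simp), fun h l _ => h l⟩

theorem mem_pairingKer_univ' {a : FreeAlgebra K X} :
    a ∈ χ.pairingKer Set.univ ↔ ∀ l, algebraMapInv (χ.iterL l a) = 0 := by
  rw [mem_pairingKer_univ]
  refine ⟨fun h l => ?_, fun h l => ?_⟩
  · rw [← l.reverse_reverse, ← algebraMapInv_iterR, h]
  · rw [algebraMapInv_iterR, h]

/-- Left words separate the left factor of the quotient and right words the right factor. Applied to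
$\Delta(a)$, such a pair gives the constant term of a left word applied to a right word of $a$,
which vanishes because the kernel is stable under right derivations. -/
theorem map_mkQ_comul {a : FreeAlgebra K X} (ha : a ∈ χ.pairingKer Set.univ) :
    TensorProduct.map (χ.pairingKer Set.univ).mkQ (χ.pairingKer Set.univ).mkQ (χ.comul a) = 0 := by
  let f (l : List X) : (FreeAlgebra K X ⧸ χ.pairingKer Set.univ) →ₗ[K] K :=
    (χ.pairingKer Set.univ).liftQ (algebraMapInv.toLinearMap ∘ₗ χ.iterL l)
      fun a ha => (χ.mem_pairingKer_univ').1 ha l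
  let g (l : List X) : (FreeAlgebra K X ⧸ χ.pairingKer Set.univ) →ₗ[K] K :=
    (χ.pairingKer Set.univ).liftQ (algebraMapInv.toLinearMap ∘ₗ χ.iterR l)
      fun a ha => χ.mem_pairingKer_univ.1 ha l
  refine TensorProduct.eq_zero_of_separating f g (fun m hm => ?_) (fun m hm => ?_) _ fun l l' => ?_
  · obtain ⟨x, rfl⟩ := (χ.pairingKer Set.univ).mkQ_surjective m
    exact (Submodule.Quotient.mk_eq_zero _).2 (χ.mem_pairingKer_univ'.2 hm)
  · obtain ⟨x, rfl⟩ := (χ.pairingKer Set.univ).mkQ_surjective m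
    exact (Submodule.Quotient.mk_eq_zero _).2 (χ.mem_pairingKer_univ.2 hm)
  · rw [← LinearMap.comp_apply, ← TensorProduct.map_comp, show f l ∘ₗ Submodule.mkQ _ = _
      from Submodule.liftQ_mkQ _ _ _, show g l' ∘ₗ Submodule.mkQ _ = _
      from Submodule.liftQ_mkQ _ _ _, TensorProduct.map_comp, LinearMap.comp_apply]
    have h : TensorProduct.map (χ.iterL l) (χ.iterR l') (χ.comul a) =
        χ.comul (χ.iterL l (χ.iterR l' a)) := by
      rw [comul_iterL, comul_iterR, ← LinearMap.rTensor_comp_lTensor, LinearMap.comp_apply]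
    rw [h, ← (TensorProduct.lid K K).map_eq_zero_iff, map_algebraMapInv_comul]
    have h' : χ.iterR l' a ∈ χ.pairingKer Set.univ := by
      clear h
      induction l' generalizing a with
      | nil => exact ha
      | cons s l' ih => exact ih (derR_mem_pairingKer (Set.mem_univ s) ha)
    exact χ.mem_pairingKer_univ'.1 h' l

/-- The common kernel of all words in the skew derivations, as an ideal. -/
def pairingIdeal : Ideal (FreeAlgebra K X) where
  __ := χ.pairingKer Set.univ
  smul_mem' a _ hb := mul_mem_pairingKer isSubrack_univ a hb

theorem restrictScalars_pairingIdeal :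
    χ.pairingIdeal.restrictScalars K = χ.pairingKer Set.univ := rfl

theorem isNicholsIdeal_pairingIdeal : χ.IsNicholsIdeal χ.pairingIdeal where
  isTwoSided := ⟨fun b ha => mul_mem_pairingKer_of_left b ha⟩
  homogeneous := by
    rw [restrictScalars_pairingIdeal]
    intro a ha
    obtain ⟨s, f, hf, rfl⟩ := exists_sum_tensorDegree a
    refine Submodule.sum_mem _ fun n hn => ?_
    have hfn : f n ∈ χ.pairingKer Set.univ := mem_pairingKer_of_sum hf ha hn
    match n, hf n, hfn with
    | 0, h0, h => rw [eq_zero_of_tensorDegree_zero h0 (algebraMapInv_eq_zero h)]; exact zero_mem _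
    | 1, h1, h =>
      rw [eq_zero_of_tensorDegree_one h1 fun s => ?_]
      · exact zero_mem _
      · rw [← χ.algebraMapInv_derR]
        exact algebraMapInv_eq_zero (derR_mem_pairingKer (Set.mem_univ s) h)
    | n + 2, hn, h => exact Submodule.mem_iSup_of_mem n ⟨h, hn⟩
  coideal := by
    rw [restrictScalars_pairingIdeal]
    rintro _ ⟨a, ha, rfl⟩
    have h := χ.map_mkQ_comul ha
    rw [← LinearMap.mem_ker, TensorProduct.map_ker
      (f := (χ.pairingKer Set.univ).subtype) (f' := (χ.pairingKer Set.univ).subtype)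
      (LinearMap.exact_subtype_mkQ _) (Submodule.mkQ_surjective _)
      (LinearMap.exact_subtype_mkQ _) (Submodule.mkQ_surjective _), sup_comm] at h
    exact h

/-- Living in degrees at least two, `J` has no constant or linear terms. The coideal condition then
makes it stable under right derivations, so every word sends it to elements without constant term.
-/
theorem IsNicholsIdeal.le_pairingIdeal {J : Ideal (FreeAlgebra K X)} (hJ : χ.IsNicholsIdeal J) :
    J ≤ χ.pairingIdeal := by
  have hlin : ∀ s, ∀ a ∈ J, linCoeff s a = 0 := fun s a ha => by
    have : J.restrictScalars K ≤ LinearMap.ker (linCoeff s) := hJ.homogeneous.trans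
      (iSup_le fun n x hx => linCoeff_eq_zero_of_tensorDegree s hx.2)
    exact this ha
  have hconst : ∀ a ∈ J, algebraMapInv a = 0 := fun a ha => by
    have : J.restrictScalars K ≤ LinearMap.ker (algebraMapInv (R := K) (X := X)).toLinearMap :=
      hJ.homogeneous.trans
      (iSup_le fun n x hx => algebraMapInv_eq_zero_of_tensorDegree (by simp) hx.2)
    exact this ha
  have hder : ∀ s, ∀ a ∈ J, χ.derR s a ∈ J := by
    intro s a ha
    have h := hJ.coideal ⟨a, ha, rfl⟩
    have hle : LinearMap.range ((J.restrictScalars K).subtype.rTensor (FreeAlgebra K X)) ⊔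
        LinearMap.range ((J.restrictScalars K).subtype.lTensor (FreeAlgebra K X)) ≤
        (J.restrictScalars K).comap
          ((TensorProduct.rid K _).toLinearMap ∘ₗ (linCoeff s).lTensor _) := by
      refine sup_le ?_ ?_
      · rintro _ ⟨z, rfl⟩
        induction z with
        | zero => simp
        | add x y hx hy => rw [map_add]; exact add_mem hx hy
        | tmul c d =>
          simpa using Submodule.smul_mem (J.restrictScalars K) (linCoeff s d) c.2
      · rintro _ ⟨z, rfl⟩
        induction z with
        | zero => simp
        | add x y hx hy => rw [map_add]; exact add_mem hx hy
        | tmul c d => simp [hlin s d d.2]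
    exact hle h
  intro a ha l _
  induction l generalizing a with
  | nil => exact hconst a ha
  | cons s l ih => exact ih (hder s a ha) (by simp)

theorem nicholsIdeal_eq : χ.nicholsIdeal = χ.pairingIdeal :=
  le_antisymm (χ.isGreatest_nicholsIdeal.1.le_pairingIdeal)
    (χ.isGreatest_nicholsIdeal.2 χ.isNicholsIdeal_pairingIdeal)

theorem mem_nicholsIdeal {a : FreeAlgebra K X} :
    a ∈ χ.nicholsIdeal ↔ a ∈ χ.pairingKer Set.univ := by
  rw [nicholsIdeal_eq]; rfl

end

/-! ### The Nichols algebra and its skew derivations -/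

noncomputable section

open FreeAlgebra

variable {X K : Type*} [Rack X] [Field K] (χ : RackCocycle X K)

/-- The projection from the tensor algebra to the Nichols algebra. -/
def proj : FreeAlgebra K X →ₐ[K] χ.NicholsAlgebra := Ideal.Quotient.mkₐ K χ.nicholsIdeal

theorem proj_surjective : Function.Surjective χ.proj := Ideal.Quotient.mk_surjective

theorem proj_eq_zero {a : FreeAlgebra K X} : χ.proj a = 0 ↔ a ∈ χ.nicholsIdeal :=
  Ideal.Quotient.eq_zero_iff_mem

theorem proj_ι (t : X) : χ.proj (ι K t) = χ.gen t := rfl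

theorem mem_degree {n : ℕ} {x : χ.NicholsAlgebra} :
    x ∈ χ.degree n ↔ ∃ a ∈ tensorDegree X K n, χ.proj a = x := Iff.rfl

theorem proj_mem_degree {n : ℕ} {a : FreeAlgebra K X} (ha : a ∈ tensorDegree X K n) :
    χ.proj a ∈ χ.degree n := ⟨a, ha, rfl⟩

theorem gen_mem_degree (t : X) : χ.gen t ∈ χ.degree 1 := χ.proj_mem_degree (ι_mem_tensorDegree t)

theorem mul_mem_degree {i j : ℕ} {x y : χ.NicholsAlgebra} (hx : x ∈ χ.degree i)
    (hy : y ∈ χ.degree j) : x * y ∈ χ.degree (i + j) := by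
  obtain ⟨a, ha, rfl⟩ := χ.mem_degree.1 hx
  obtain ⟨b, hb, rfl⟩ := χ.mem_degree.1 hy
  rw [← map_mul]
  refine χ.proj_mem_degree ?_
  rw [tensorDegree, pow_add]
  exact Submodule.mul_mem_mul ha hb

/-- The endomorphism of the Nichols algebra induced by an endomorphism of the tensor algebra. -/
def descend (f : FreeAlgebra K X →ₗ[K] FreeAlgebra K X) : χ.NicholsAlgebra →ₗ[K] χ.NicholsAlgebra :=
  χ.proj.toLinearMap ∘ₗ f ∘ₗ (χ.proj.toLinearMap.exists_rightInverse_of_surjective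
    (LinearMap.range_eq_top.2 χ.proj_surjective)).choose

theorem descend_proj {f : FreeAlgebra K X →ₗ[K] FreeAlgebra K X}
    (hf : ∀ a ∈ χ.nicholsIdeal, f a ∈ χ.nicholsIdeal) (a : FreeAlgebra K X) :
    χ.descend f (χ.proj a) = χ.proj (f a) := by
  have h := (χ.proj.toLinearMap.exists_rightInverse_of_surjective
    (LinearMap.range_eq_top.2 χ.proj_surjective)).choose_spec
  rw [← sub_eq_zero, descend, LinearMap.comp_apply, LinearMap.comp_apply,
    AlgHom.toLinearMap_apply, ← map_sub, ← map_sub, proj_eq_zero]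
  refine hf _ ?_
  rw [← proj_eq_zero, map_sub, sub_eq_zero]
  exact DFunLike.congr_fun h (χ.proj a)

theorem gen_mem_nicholsSubalgebra {S : Set X} {t : X} (ht : t ∈ S) : χ.gen t ∈ χ.nicholsSubalgebra S :=
  Algebra.subset_adjoin ⟨t, ht, rfl⟩

variable [DecidableEq X]

/-- The counit of the Nichols algebra. -/
def counit : χ.NicholsAlgebra →ₐ[K] K :=
  Ideal.Quotient.liftₐ χ.nicholsIdeal algebraMapInv fun _ ha =>
    algebraMapInv_eq_zero (χ.mem_nicholsIdeal.1 ha)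

theorem counit_proj (a : FreeAlgebra K X) : χ.counit (χ.proj a) = algebraMapInv a := rfl

/-- The action of `g_t` on the Nichols algebra. -/
def twist (t : X) : χ.NicholsAlgebra →ₐ[K] χ.NicholsAlgebra :=
  Ideal.Quotient.liftₐ χ.nicholsIdeal (χ.proj.comp (χ.act t)) fun _ ha => χ.proj_eq_zero.2
    (χ.mem_nicholsIdeal.2
      (act_mem_pairingKer isSubrack_univ (Set.mem_univ t) (χ.mem_nicholsIdeal.1 ha)))

theorem twist_proj (t : X) (a : FreeAlgebra K X) : χ.twist t (χ.proj a) = χ.proj (χ.act t a) := rfl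

theorem twist_gen (t s : X) : χ.twist t (χ.gen s) = (χ.val t s : K) • χ.gen (t ◃ s) := by
  rw [← proj_ι, twist_proj, act_ι, map_smul, proj_ι]

/-- The right skew derivations of the Nichols algebra. -/
def skewR (s : X) : Module.End K χ.NicholsAlgebra := χ.descend (χ.derR s)

/-- The left skew derivations of the Nichols algebra. -/
def skewL (s : X) : Module.End K χ.NicholsAlgebra := χ.descend (χ.derL s)

theorem skewR_proj (s : X) (a : FreeAlgebra K X) : χ.skewR s (χ.proj a) = χ.proj (χ.derR s a) :=
  χ.descend_proj (fun _ ha => χ.mem_nicholsIdeal.2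
    (derR_mem_pairingKer (Set.mem_univ s) (χ.mem_nicholsIdeal.1 ha))) a

theorem skewL_proj (s : X) (a : FreeAlgebra K X) : χ.skewL s (χ.proj a) = χ.proj (χ.derL s a) :=
  χ.descend_proj (fun _ ha => χ.mem_nicholsIdeal.2
    (derL_mem_pairingKer_univ s (χ.mem_nicholsIdeal.1 ha))) a

theorem skewR_mul (s : X) (x y : χ.NicholsAlgebra) :
    χ.skewR s (x * y) = x * χ.skewR s y + χ.skewR s x * χ.twist s y := by
  obtain ⟨a, rfl⟩ := χ.proj_surjective x
  obtain ⟨b, rfl⟩ := χ.proj_surjective y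
  rw [← map_mul, skewR_proj, skewR_proj, skewR_proj, twist_proj, derR_mul, map_add, map_mul,
    map_mul]

theorem skewR_one (s : X) : χ.skewR s 1 = 0 := by
  rw [← map_one χ.proj, skewR_proj, derR_one, map_zero]

theorem skewR_gen (s t : X) : χ.skewR s (χ.gen t) = if t = s then 1 else 0 := by
  have h := χ.derR_ι_mul s t 1
  rw [mul_one, derR_one, mul_zero, zero_add, map_one] at h
  rw [← proj_ι, skewR_proj, h]
  split_ifs <;> simp

theorem skewL_gen_mul {t s r : X} (hr : t ◃ s = r) (x : χ.NicholsAlgebra) :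
    χ.skewL r (χ.gen t * x) =
      (if t = r then x else 0) + (χ.val t s : K) • (χ.gen t * χ.skewL s x) := by
  obtain ⟨a, rfl⟩ := χ.proj_surjective x
  rw [← proj_ι, ← map_mul, skewL_proj, skewL_proj, χ.derL_ι_mul hr, map_add, map_smul, map_mul]
  split_ifs <;> simp

theorem skewL_skewR (r s : X) (x : χ.NicholsAlgebra) :
    χ.skewL r (χ.skewR s x) = χ.skewR s (χ.skewL r x) := by
  obtain ⟨a, rfl⟩ := χ.proj_surjective x
  rw [skewR_proj, skewL_proj, skewL_proj, skewR_proj, derL_derR]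

theorem skewR_mem_degree (s : X) {n : ℕ} {x : χ.NicholsAlgebra} (hx : x ∈ χ.degree (n + 1)) :
    χ.skewR s x ∈ χ.degree n := by
  obtain ⟨a, ha, rfl⟩ := χ.mem_degree.1 hx
  rw [skewR_proj]
  exact χ.proj_mem_degree (derR_tensorDegree s ha).2

theorem skewR_eq_zero (s : X) {x : χ.NicholsAlgebra} (hx : x ∈ χ.degree 0) :
    χ.skewR s x = 0 := by
  obtain ⟨a, ha, rfl⟩ := χ.mem_degree.1 hx
  rw [skewR_proj, (derR_tensorDegree s ha).1 rfl, map_zero]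

theorem skewL_mem_degree (s : X) {n : ℕ} {x : χ.NicholsAlgebra} (hx : x ∈ χ.degree (n + 1)) :
    χ.skewL s x ∈ χ.degree n := by
  obtain ⟨a, ha, rfl⟩ := χ.mem_degree.1 hx
  rw [skewL_proj]
  exact χ.proj_mem_degree (derL_tensorDegree s ha).2

theorem skewL_eq_zero (s : X) {x : χ.NicholsAlgebra} (hx : x ∈ χ.degree 0) :
    χ.skewL s x = 0 := by
  obtain ⟨a, ha, rfl⟩ := χ.mem_degree.1 hx
  rw [skewL_proj, (derL_tensorDegree s ha).1 rfl, map_zero]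

theorem eq_algebraMap_counit {x : χ.NicholsAlgebra} (hx : x ∈ χ.degree 0) :
    x = algebraMap K _ (χ.counit x) := by
  obtain ⟨a, ha, rfl⟩ := χ.mem_degree.1 hx
  obtain ⟨c, rfl⟩ := Submodule.mem_one.1 (by simpa [tensorDegree] using ha)
  rw [AlgHom.commutes, AlgHom.commutes]
  simp

/-- The composition of right skew derivations along a word; the first letter acts first. -/
def wordR : List X → Module.End K χ.NicholsAlgebra
  | [] => LinearMap.id
  | s :: l => wordR l ∘ₗ χ.skewR s

/-- The composition of left skew derivations along a word; the first letter acts first. -/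
def wordL : List X → Module.End K χ.NicholsAlgebra
  | [] => LinearMap.id
  | s :: l => wordL l ∘ₗ χ.skewL s

theorem wordR_proj (l : List X) (a : FreeAlgebra K X) :
    χ.wordR l (χ.proj a) = χ.proj (χ.iterR l a) := by
  induction l generalizing a with
  | nil => rfl
  | cons s l ih => simp [wordR, iterR, skewR_proj, ih]

theorem wordL_proj (l : List X) (a : FreeAlgebra K X) :
    χ.wordL l (χ.proj a) = χ.proj (χ.iterL l a) := by
  induction l generalizing a with
  | nil => rfl
  | cons s l ih => simp [wordL, iterL, skewL_proj, ih]

theorem wordR_append (l : List X) (s : X) :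
    χ.wordR (l ++ [s]) = χ.skewR s ∘ₗ χ.wordR l := by
  induction l with
  | nil => rfl
  | cons r l ih => exact congrArg (· ∘ₗ χ.skewR r) ih

theorem wordR_wordL (l l' : List X) (x : χ.NicholsAlgebra) :
    χ.wordR l (χ.wordL l' x) = χ.wordL l' (χ.wordR l x) := by
  have h (s : X) (x : χ.NicholsAlgebra) : χ.skewR s (χ.wordL l' x) = χ.wordL l' (χ.skewR s x) := by
    induction l' generalizing x with
    | nil => rfl
    | cons r l' ih => exact (ih _).trans (congrArg _ (χ.skewL_skewR r s x).symm)
  induction l generalizing x with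
  | nil => rfl
  | cons s l ih => exact (congrArg _ (h s x)).trans (ih _)

theorem eq_zero_of_wordR {x : χ.NicholsAlgebra} (hx : ∀ l, χ.counit (χ.wordR l x) = 0) : x = 0 := by
  obtain ⟨a, rfl⟩ := χ.proj_surjective x
  refine χ.proj_eq_zero.2 (χ.mem_nicholsIdeal.2 (χ.mem_pairingKer_univ.2 fun l => ?_))
  rw [← counit_proj, ← wordR_proj, hx]

theorem eq_zero_of_wordL {x : χ.NicholsAlgebra} (hx : ∀ l, χ.counit (χ.wordL l x) = 0) : x = 0 := by
  obtain ⟨a, rfl⟩ := χ.proj_surjective x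
  refine χ.proj_eq_zero.2 (χ.mem_nicholsIdeal.2 (χ.mem_pairingKer_univ'.2 fun l => ?_))
  rw [← counit_proj, ← wordL_proj, hx]

theorem counit_wordR_of_degree (l : List X) {n : ℕ} (hn : n ≠ l.length) {x : χ.NicholsAlgebra}
    (hx : x ∈ χ.degree n) : χ.counit (χ.wordR l x) = 0 := by
  obtain ⟨a, ha, rfl⟩ := χ.mem_degree.1 hx
  rw [wordR_proj, counit_proj, algebraMapInv_iterR_of_tensorDegree l hn ha]

theorem wordR_mem_degree (l : List X) {i : ℕ} {x : χ.NicholsAlgebra}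
    (hx : x ∈ χ.degree (l.length + i)) : χ.wordR l x ∈ χ.degree i := by
  induction l generalizing x with
  | nil => simpa [wordR] using hx
  | cons s l ih =>
    refine ih (χ.skewR_mem_degree s ?_)
    rwa [List.length_cons, add_right_comm] at hx

theorem wordR_eq_zero (l : List X) {n : ℕ} (hn : n < l.length) {x : χ.NicholsAlgebra}
    (hx : x ∈ χ.degree n) : χ.wordR l x = 0 := by
  induction l generalizing x n with
  | nil => simp at hn
  | cons s l ih =>
    change χ.wordR l (χ.skewR s x) = 0
    cases n with
    | zero => rw [χ.skewR_eq_zero s hx, map_zero]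
    | succ n => exact ih (by simpa using hn) (χ.skewR_mem_degree s hx)

theorem iSupIndep_degree : iSupIndep χ.degree := by
  classical
  refine iSupIndep_of_dfinsupp_lsum_injective _ ((injective_iff_map_eq_zero _).2 fun f hf => ?_)
  choose g hg hgf using fun n => χ.mem_degree.1 (f n).2
  have hsum : ∑ n ∈ f.support, g n ∈ χ.pairingKer Set.univ := by
    rw [← mem_nicholsIdeal, ← proj_eq_zero, map_sum, Finset.sum_congr rfl fun n _ => hgf n]
    simpa [DFinsupp.lsum_apply_apply, DFinsupp.sumAddHom_apply, DFinsupp.sum] using hf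
  ext n
  by_cases hn : n ∈ f.support
  · rw [← hgf n, χ.proj_eq_zero.2 (χ.mem_nicholsIdeal.2 (mem_pairingKer_of_sum hg hsum hn))]
    rfl
  · rw [DFinsupp.notMem_support_iff.1 hn]
    rfl

theorem exists_degree_eq_bot [Module.Finite K χ.NicholsAlgebra] :
    ∃ N, ∀ n, N < n → χ.degree n = ⊥ := by
  obtain ⟨N, hN⟩ := (WellFoundedGT.finite_ne_bot_of_iSupIndep χ.iSupIndep_degree).bddAbove
  refine ⟨N, fun n hn => ?_⟩
  by_contra h
  exact absurd (hN h) (not_le.2 hn)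

/-! ### Subalgebras of subracks -/

variable {S : Set X}

theorem twist_mem_nicholsSubalgebra (hS : IsSubrack S) {t : X} (ht : t ∈ S) {x : χ.NicholsAlgebra}
    (hx : x ∈ χ.nicholsSubalgebra S) : χ.twist t x ∈ χ.nicholsSubalgebra S := by
  have h : χ.nicholsSubalgebra S ≤ (χ.nicholsSubalgebra S).comap (χ.twist t) := by
    refine Algebra.adjoin_le ?_
    rintro _ ⟨s, hs, rfl⟩
    change χ.twist t (χ.gen s) ∈ χ.nicholsSubalgebra S
    rw [twist_gen]
    exact Subalgebra.smul_mem _ (χ.gen_mem_nicholsSubalgebra ((hS t ht).mapsTo hs)) _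
  exact h hx

theorem skewR_mem_nicholsSubalgebra (hS : IsSubrack S) {s : X} (hs : s ∈ S) {x : χ.NicholsAlgebra}
    (hx : x ∈ χ.nicholsSubalgebra S) : χ.skewR s x ∈ χ.nicholsSubalgebra S := by
  induction hx using Algebra.adjoin_induction with
  | mem x hx =>
    obtain ⟨t, -, rfl⟩ := hx
    rw [skewR_gen]
    split_ifs
    · exact one_mem _
    · exact zero_mem _
  | algebraMap r =>
    rw [Algebra.algebraMap_eq_smul_one, map_smul, skewR_one, smul_zero]
    exact zero_mem _
  | add x y _ _ hx hy => rw [map_add]; exact add_mem hx hy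
  | mul x y hx' hy' hx hy =>
    rw [skewR_mul]
    exact add_mem (mul_mem hx' hy) (mul_mem hx (χ.twist_mem_nicholsSubalgebra hS hs hy'))

theorem skewR_nicholsSubalgebra_eq_zero {s : X} (hs : s ∉ S) {x : χ.NicholsAlgebra}
    (hx : x ∈ χ.nicholsSubalgebra S) : χ.skewR s x = 0 := by
  induction hx using Algebra.adjoin_induction with
  | mem x hx =>
    obtain ⟨t, ht, rfl⟩ := hx
    rw [skewR_gen, if_neg fun h : t = s => hs (h ▸ ht)]
  | algebraMap r => rw [Algebra.algebraMap_eq_smul_one, map_smul, skewR_one, smul_zero]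
  | add x y _ _ hx hy => rw [map_add, hx, hy, add_zero]
  | mul x y _ _ hx hy => rw [skewR_mul, hx, hy, mul_zero, zero_mul, add_zero]

theorem wordR_nicholsSubalgebra_eq_zero (hS : IsSubrack S) {l : List X} (hl : ¬ ∀ s ∈ l, s ∈ S)
    {x : χ.NicholsAlgebra} (hx : x ∈ χ.nicholsSubalgebra S) : χ.wordR l x = 0 := by
  induction l generalizing x with
  | nil => simp at hl
  | cons s l ih =>
    change χ.wordR l (χ.skewR s x) = 0
    by_cases hs : s ∈ S
    · exact ih (fun h => hl (by simpa [hs] using h)) (χ.skewR_mem_nicholsSubalgebra hS hs hx)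
    · rw [χ.skewR_nicholsSubalgebra_eq_zero hs hx, map_zero]

/-- Discard from a representative all monomials with a letter outside `S`: they lie in the two-sided
ideal `pairingKer S`, hence are invisible to words in `S`. -/
theorem exists_mem_nicholsSubalgebra (hS : IsSubrack S) {n : ℕ} {x : χ.NicholsAlgebra}
    (hx : x ∈ χ.degree n) : ∃ b ∈ χ.nicholsSubalgebra S, b ∈ χ.degree n ∧
      ∀ l : List X, (∀ s ∈ l, s ∈ S) → χ.counit (χ.wordR l x) = χ.counit (χ.wordR l b) := by
  obtain ⟨a, ha, rfl⟩ := χ.mem_degree.1 hx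
  suffices h : ∃ b ∈ tensorDegree X K n, χ.proj b ∈ χ.nicholsSubalgebra S ∧
      a - b ∈ χ.pairingKer S by
    obtain ⟨b, hb, hbS, hab⟩ := h
    refine ⟨χ.proj b, hbS, χ.proj_mem_degree hb, fun l hl => ?_⟩
    rw [wordR_proj, wordR_proj, counit_proj, counit_proj, ← sub_eq_zero, ← map_sub, ← map_sub]
    exact hab l hl
  refine tensorDegree_induction (p := fun n a => ∃ b ∈ tensorDegree X K n,
    χ.proj b ∈ χ.nicholsSubalgebra S ∧ a - b ∈ χ.pairingKer S) ?_ ?_ ?_ ?_ ?_ ha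
  · exact fun n => ⟨0, zero_mem _, by simp, by simp⟩
  · rintro n a a' ⟨b, hb, hbS, hab⟩ ⟨b', hb', hbS', hab'⟩
    refine ⟨b + b', add_mem hb hb', ?_, ?_⟩
    · rw [map_add]; exact add_mem hbS hbS'
    · rw [add_sub_add_comm]; exact add_mem hab hab'
  · rintro n c a ⟨b, hb, hbS, hab⟩
    refine ⟨c • b, Submodule.smul_mem _ _ hb, ?_, ?_⟩
    · rw [map_smul]; exact Subalgebra.smul_mem _ hbS c
    · rw [← smul_sub]; exact Submodule.smul_mem _ _ hab
  · exact ⟨1, one_mem_tensorDegree, by simp, by simp⟩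
  · rintro n t a - ⟨b, hb, hbS, hab⟩
    by_cases ht : t ∈ S
    · refine ⟨ι K t * b, ι_mul_mem_tensorDegree t hb, ?_, ?_⟩
      · rw [map_mul]; exact mul_mem (χ.gen_mem_nicholsSubalgebra ht) hbS
      · rw [← mul_sub]; exact mul_mem_pairingKer hS _ hab
    · refine ⟨0, zero_mem _, by simp, ?_⟩
      rw [sub_zero]
      exact mul_mem_pairingKer_of_left _ (ι_mem_pairingKer ht)

end

end RackCocycle

/-! ### Dimension counts and duality -/

section LinearAlgebra

variable {K M N : Type*} [Field K] [AddCommGroup M] [Module K M] [AddCommGroup N] [Module K N]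

/-- The hypotheses say that `f` induces an isomorphism $A/A'\cong C/C'$. -/
theorem LinearMap.finrank_add_finrank_of_induced_equiv (f : M →ₗ[K] N) {A A' : Submodule K M}
    {C C' : Submodule K N} [FiniteDimensional K A] [FiniteDimensional K C]
    (hA : A' ≤ A) (hC : C' ≤ C) (hf : ∀ x ∈ A, f x ∈ C) (hf' : ∀ x ∈ A, f x ∈ C' ↔ x ∈ A')
    (hs : ∀ y ∈ C, ∃ x ∈ A, f x - y ∈ C') :
    Module.finrank K A + Module.finrank K C' = Module.finrank K C + Module.finrank K A' := by
  let P := C'.comap C.subtype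
  let g : A →ₗ[K] C ⧸ P := P.mkQ ∘ₗ f.restrict hf
  have hker : LinearMap.ker g = A'.comap A.subtype := by
    ext x
    simp only [g, P, LinearMap.mem_ker, LinearMap.comp_apply, Submodule.mkQ_apply,
      Submodule.Quotient.mk_eq_zero, Submodule.mem_comap, Submodule.subtype_apply,
      LinearMap.coe_restrict_apply]
    exact hf' x x.2
  have hrange : LinearMap.range g = ⊤ := by
    refine LinearMap.range_eq_top.2 fun y => ?_
    obtain ⟨y, rfl⟩ := P.mkQ_surjective y
    obtain ⟨x, hx, hxy⟩ := hs y y.2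
    exact ⟨⟨x, hx⟩, (Submodule.Quotient.eq P).2 hxy⟩
  have h1 := g.finrank_range_add_finrank_ker
  have h2 := P.finrank_quotient_add_finrank
  have h3 := (Submodule.comapSubtypeEquivOfLe hA).finrank_eq
  have h4 := (Submodule.comapSubtypeEquivOfLe hC).finrank_eq
  rw [hrange, finrank_top, hker, h3] at h1
  change _ + Module.finrank K (C'.comap C.subtype) = _ at h2
  lia

theorem Submodule.eq_top_of_separating [FiniteDimensional K M]
    (W : Submodule K (Module.Dual K M)) (h : ∀ v, (∀ φ ∈ W, φ v = 0) → v = 0) : W = ⊤ := by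
  have hW : W.dualCoannihilator = ⊥ := (Submodule.eq_bot_iff _).2 fun v hv =>
    h v ((Submodule.mem_dualCoannihilator v).1 hv)
  rw [← Subspace.dualCoannihilator_dualAnnihilator_eq (W := W), hW,
    Submodule.dualAnnihilator_bot]

theorem Submodule.finrank_pi_univ {ι : Type*} [Fintype ι] (W : Submodule K M)
    [FiniteDimensional K W] :
    Module.finrank K (Submodule.pi Set.univ fun _ : ι => W) =
      Fintype.card ι * Module.finrank K W := by
  let e : (Submodule.pi Set.univ fun _ : ι => W) ≃ₗ[K] (ι → W) :=
    { toFun := fun w i => ⟨w.1 i, w.2 i trivial⟩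
      invFun := fun w => ⟨fun i => w i, fun i _ => (w i).2⟩
      map_add' := fun _ _ => rfl
      map_smul' := fun _ _ => rfl
      left_inv := fun _ => rfl
      right_inv := fun _ => rfl }
  rw [e.finrank_eq, Module.finrank_pi_fintype]
  simp

end LinearAlgebra

/-! ### Factorisation of the Hilbert series over the subalgebra of a subrack -/

namespace RackCocycle

noncomputable section

variable {X K : Type*} [Rack X] [Field K] (χ : RackCocycle X K) [DecidableEq X] (S : Set X)

/-- The common kernel of the right skew derivations belonging to `S`. -/
def invariants : Submodule K χ.NicholsAlgebra where
  carrier := {x | ∀ s ∈ S, χ.skewR s x = 0}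
  zero_mem' := fun _ _ => map_zero _
  add_mem' := fun hx hy s hs => by rw [map_add, hx s hs, hy s hs, add_zero]
  smul_mem' := fun c x hx s hs => by rw [map_smul, hx s hs, smul_zero]

/-- The span of the words of length `j` in the right skew derivations belonging to `S`. -/
def wordSpan (j : ℕ) : Submodule K (Module.End K χ.NicholsAlgebra) :=
  Submodule.span K (χ.wordR '' {l | l.length = j ∧ ∀ s ∈ l, s ∈ S})

/-- The degree `j` part of the subalgebra generated by `S`. -/
def subalgebraDegree (j : ℕ) : Submodule K χ.NicholsAlgebra :=
  Subalgebra.toSubmodule (χ.nicholsSubalgebra S) ⊓ χ.degree j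

/-- The pairing of skew derivations with the degree `j` part of the subalgebra. -/
def wordPairing (j : ℕ) :
    Module.End K χ.NicholsAlgebra →ₗ[K] Module.Dual K (χ.subalgebraDegree S j) where
  toFun f := χ.counit.toLinearMap ∘ₗ f ∘ₗ (χ.subalgebraDegree S j).subtype
  map_add' f g := by ext; simp
  map_smul' c f := by ext; simp

variable {χ S} {j : ℕ}

theorem wordR_mem_wordSpan {l : List X} (hl : ∀ s ∈ l, s ∈ S) :
    χ.wordR l ∈ χ.wordSpan S l.length :=
  Submodule.subset_span ⟨l, ⟨rfl, hl⟩, rfl⟩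

theorem wordSpan_le {P : Submodule K (Module.End K χ.NicholsAlgebra)}
    (h : ∀ l : List X, l.length = j → (∀ s ∈ l, s ∈ S) → χ.wordR l ∈ P) : χ.wordSpan S j ≤ P :=
  Submodule.span_le.2 fun _ ⟨l, hl, hlf⟩ => hlf ▸ h l hl.1 hl.2

theorem wordSpan_induction {P : Module.End K χ.NicholsAlgebra → Prop}
    (word : ∀ l : List X, l.length = j → (∀ s ∈ l, s ∈ S) → P (χ.wordR l)) (zero : P 0)
    (add : ∀ f g, P f → P g → P (f + g)) (smul : ∀ (c : K) f, P f → P (c • f))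
    {f : Module.End K χ.NicholsAlgebra} (hf : f ∈ χ.wordSpan S j) : P f := by
  induction hf using Submodule.span_induction with
  | mem f hf => obtain ⟨l, hl, rfl⟩ := hf; exact word l hl.1 hl.2
  | zero => exact zero
  | add f g _ _ hf hg => exact add f g hf hg
  | smul c f _ hf => exact smul c f hf

theorem wordSpan_mem_degree {f : Module.End K χ.NicholsAlgebra} (hf : f ∈ χ.wordSpan S j) {i : ℕ}
    {x : χ.NicholsAlgebra} (hx : x ∈ χ.degree (j + i)) : f x ∈ χ.degree i := by
  refine wordSpan_induction (P := fun f => f x ∈ χ.degree i) (fun l hl _ => ?_) (zero_mem _)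
    (fun f g hf hg => add_mem hf hg) (fun c f hf => Submodule.smul_mem _ c hf) hf
  subst hl
  exact χ.wordR_mem_degree l hx

theorem wordSpan_eq_zero_of_lt {f : Module.End K χ.NicholsAlgebra} (hf : f ∈ χ.wordSpan S j)
    {n : ℕ} (hn : n < j) {x : χ.NicholsAlgebra} (hx : x ∈ χ.degree n) : f x = 0 := by
  refine wordSpan_induction (P := fun f => f x = 0) (fun l hl _ => ?_) rfl
    (fun f g hf hg => by simp [hf, hg]) (fun c f hf => by simp [hf]) hf
  subst hl
  exact χ.wordR_eq_zero l hn hx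

theorem skewR_comp_mem_wordSpan {s : X} (hs : s ∈ S) {f : Module.End K χ.NicholsAlgebra}
    (hf : f ∈ χ.wordSpan S j) : χ.skewR s ∘ₗ f ∈ χ.wordSpan S (j + 1) := by
  refine wordSpan_induction (P := fun f => χ.skewR s ∘ₗ f ∈ χ.wordSpan S (j + 1))
    (fun l hl hlS => ?_) (by simp) (fun f g hf hg => ?_) (fun c f hf => ?_) hf
  · rw [← wordR_append, ← hl, show l.length + 1 = (l ++ [s]).length by simp]
    refine wordR_mem_wordSpan fun r hr => ?_
    rcases List.mem_append.1 hr with hr | hr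
    · exact hlS r hr
    · rwa [List.mem_singleton.1 hr]
  · rw [LinearMap.comp_add]; exact add_mem hf hg
  · rw [LinearMap.comp_smul]; exact Submodule.smul_mem _ _ hf

theorem wordSpan_succ_eq_zero {x : χ.NicholsAlgebra} (hx : ∀ f ∈ χ.wordSpan S j, f x = 0)
    {f : Module.End K χ.NicholsAlgebra} (hf : f ∈ χ.wordSpan S (j + 1)) : f x = 0 := by
  refine wordSpan_induction (P := fun f => f x = 0) (fun l hl hlS => ?_) rfl
    (fun f g hf hg => by simp [hf, hg]) (fun c f hf => by simp [hf]) hf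
  have hne : l ≠ [] := by rintro rfl; simp at hl
  obtain ⟨l', s, rfl⟩ : ∃ l' s, l = l' ++ [s] :=
    ⟨_, _, (List.dropLast_append_getLast hne).symm⟩
  have hl' : l'.length = j := by simpa using hl
  rw [wordR_append, LinearMap.comp_apply, hx _ (hl' ▸ wordR_mem_wordSpan fun r hr =>
    hlS r (by simp [hr])), map_zero]

/-- In the Leibniz rule the twisted term contains the derivative of `k`, which is zero. -/
theorem wordSpan_mul {k : χ.NicholsAlgebra} (hk : k ∈ χ.invariants S)
    {f : Module.End K χ.NicholsAlgebra} (hf : f ∈ χ.wordSpan S j) (x : χ.NicholsAlgebra) :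
    f (k * x) = k * f x := by
  refine wordSpan_induction (P := fun f => f (k * x) = k * f x) (fun l hlj hl => ?_) (by simp)
    (fun f g hf hg => by simp [hf, hg, mul_add]) (fun c f hf => by simp [hf]) hf
  clear hlj hf
  induction l generalizing x with
  | nil => rfl
  | cons s l ih =>
    change χ.wordR l (χ.skewR s (k * x)) = k * χ.wordR l (χ.skewR s x)
    rw [skewR_mul, hk s (hl s (by simp)), zero_mul, add_zero,
      ih _ fun r hr => hl r (List.mem_cons_of_mem s hr)]

theorem wordSpan_apply_subalgebraDegree {f : Module.End K χ.NicholsAlgebra}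
    (hf : f ∈ χ.wordSpan S j) (b : χ.subalgebraDegree S j) :
    f b = algebraMap K _ (χ.wordPairing S j f b) :=
  χ.eq_algebraMap_counit (wordSpan_mem_degree hf (i := 0) b.2.2)

theorem wordSpan_eqOn {M : Type*} [AddCommGroup M] [Module K M]
    {φ ψ : Module.End K χ.NicholsAlgebra →ₗ[K] M}
    (h : ∀ l : List X, l.length = j → (∀ s ∈ l, s ∈ S) → φ (χ.wordR l) = ψ (χ.wordR l))
    {f : Module.End K χ.NicholsAlgebra} (hf : f ∈ χ.wordSpan S j) : φ f = ψ f :=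
  wordSpan_le (P := LinearMap.eqLocus φ ψ) h hf

theorem counit_wordSpan_eq_zero (hS : IsSubrack S) {f : Module.End K χ.NicholsAlgebra}
    (hf : f ∈ χ.wordSpan S j) (h : χ.wordPairing S j f = 0) (x : χ.NicholsAlgebra) :
    χ.counit (f x) = 0 := by
  let φ (x : χ.NicholsAlgebra) : Module.End K χ.NicholsAlgebra →ₗ[K] K :=
    χ.counit.toLinearMap ∘ₗ LinearMap.applyₗ x
  obtain ⟨a, rfl⟩ := χ.proj_surjective x
  obtain ⟨t, g, hg, rfl⟩ := exists_sum_tensorDegree a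
  rw [map_sum, map_sum, map_sum]
  refine Finset.sum_eq_zero fun n _ => ?_
  have hgn := χ.proj_mem_degree (hg n)
  by_cases hn : n = j
  · subst hn
    obtain ⟨b, hbS, hb, hl⟩ := χ.exists_mem_nicholsSubalgebra hS hgn
    exact (wordSpan_eqOn (φ := φ (χ.proj (g n))) (ψ := φ b) (fun l _ => hl l) hf).trans
      (DFunLike.congr_fun h ⟨b, hbS, hb⟩)
  · exact wordSpan_eqOn (φ := φ (χ.proj (g n))) (ψ := 0)
      (fun l hl _ => χ.counit_wordR_of_degree l (hl ▸ hn) hgn) hf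

/-- By `counit_wordSpan_eq_zero` the counit vanishes on the whole image of `f`. As `f` commutes with
left words, all left words of `f x` have zero counit, and these separate points. -/
theorem wordPairing_injOn (hS : IsSubrack S) {f : Module.End K χ.NicholsAlgebra}
    (hf : f ∈ χ.wordSpan S j) (h : χ.wordPairing S j f = 0) : f = 0 := by
  refine LinearMap.ext fun x => χ.eq_zero_of_wordL fun l => ?_
  have hcomm : χ.wordL l (f x) = f (χ.wordL l x) :=
    wordSpan_eqOn (φ := χ.wordL l ∘ₗ LinearMap.applyₗ x) (ψ := LinearMap.applyₗ (χ.wordL l x))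
      (fun l' _ _ => (χ.wordR_wordL l' l x).symm) hf
  rw [hcomm, counit_wordSpan_eq_zero hS hf h]

variable [Module.Finite K χ.NicholsAlgebra]

theorem wordPairing_surjOn (hS : IsSubrack S) (j : ℕ) :
    (χ.wordSpan S j).map (χ.wordPairing S j) = ⊤ := by
  refine Submodule.eq_top_of_separating _ fun b hb => Subtype.ext (χ.eq_zero_of_wordR fun l => ?_)
  by_cases hlj : l.length = j
  · by_cases hl : ∀ s ∈ l, s ∈ S
    · exact hb _ ⟨_, hlj ▸ wordR_mem_wordSpan hl, rfl⟩
    · rw [χ.wordR_nicholsSubalgebra_eq_zero hS hl b.2.1, map_zero]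
  · exact χ.counit_wordR_of_degree l (Ne.symm hlj) b.2.2

theorem exists_wordSpan_dualBasis (hS : IsSubrack S) (j : ℕ) :
    ∃ (b : Fin (Module.finrank K (χ.subalgebraDegree S j)) → χ.subalgebraDegree S j)
      (f : Fin (Module.finrank K (χ.subalgebraDegree S j)) → Module.End K χ.NicholsAlgebra),
      (∀ a, f a ∈ χ.wordSpan S j) ∧
      (∀ a c, χ.wordPairing S j (f a) (b c) = if a = c then 1 else 0) ∧
      ∀ g ∈ χ.wordSpan S j, g = ∑ a, χ.wordPairing S j g (b a) • f a := by
  let b := Module.finBasis K (χ.subalgebraDegree S j)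
  have h : ∀ a, ∃ f ∈ χ.wordSpan S j, χ.wordPairing S j f = b.coord a := fun a => by
    have : b.coord a ∈ (χ.wordSpan S j).map (χ.wordPairing S j) := by
      rw [wordPairing_surjOn hS]; trivial
    exact this
  choose f hf hfb using h
  have hdual : ∀ a c, χ.wordPairing S j (f a) (b c) = if a = c then 1 else 0 := fun a c => by
    rw [hfb, Module.Basis.coord_apply, Module.Basis.repr_self, Finsupp.single_apply]
    simp [eq_comm]
  refine ⟨b, f, hf, hdual, fun g hg => sub_eq_zero.1 (wordPairing_injOn hS
    (sub_mem hg (sum_mem fun a _ => Submodule.smul_mem _ _ (hf a))) ?_)⟩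
  refine b.ext fun c => ?_
  simp [hdual]

variable (χ S) in
/-- The elements of degree `n` killed by all words of length `j` in the skew derivations
belonging to `S`. -/
def wordFiltration (j n : ℕ) : Submodule K χ.NicholsAlgebra where
  carrier := {x | x ∈ χ.degree n ∧ ∀ f ∈ χ.wordSpan S j, f x = 0}
  zero_mem' := ⟨zero_mem _, fun _ _ => map_zero _⟩
  add_mem' := fun hx hy => ⟨add_mem hx.1 hy.1, fun f hf => by
    rw [map_add, hx.2 f hf, hy.2 f hf, add_zero]⟩
  smul_mem' := fun c x hx => ⟨Submodule.smul_mem _ c hx.1, fun f hf => by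
    rw [map_smul, hx.2 f hf, smul_zero]⟩

/-- With dual bases of words and of $\mathfrak B'(j)$, applying the words identifies the layer of
the filtration with copies of $\mathcal K(i)$, one for each basis element. -/
theorem finrank_wordFiltration_succ (hS : IsSubrack S) (j i : ℕ) :
    Module.finrank K (χ.wordFiltration S (j + 1) (j + i)) =
      Module.finrank K (χ.subalgebraDegree S j) *
        Module.finrank K ↥(χ.invariants S ⊓ χ.degree i) +
        Module.finrank K (χ.wordFiltration S j (j + i)) := by
  obtain ⟨b, f, hf, hdual, hexp⟩ := exists_wordSpan_dualBasis (χ := χ) hS j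
  let W : Submodule K χ.NicholsAlgebra := χ.invariants S ⊓ χ.degree i
  have h := LinearMap.finrank_add_finrank_of_induced_equiv (LinearMap.pi f)
    (A := χ.wordFiltration S (j + 1) (j + i)) (A' := χ.wordFiltration S j (j + i))
    (C := Submodule.pi Set.univ fun _ => W) (C' := ⊥)
    (fun x hx => ⟨hx.1, fun g hg => wordSpan_succ_eq_zero hx.2 hg⟩) bot_le
    (fun x hx a _ => ⟨fun s hs => hx.2 _ (skewR_comp_mem_wordSpan hs (hf a)),
      wordSpan_mem_degree (hf a) hx.1⟩) ?_ ?_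
  · rw [finrank_bot, add_zero, Submodule.finrank_pi_univ, Fintype.card_fin] at h
    exact h
  · intro x hx
    refine ⟨fun h => ⟨hx.1, fun g hg => ?_⟩, fun h => ?_⟩
    · rw [hexp g hg]
      have h' : ∀ a, f a x = 0 := fun a => congrFun ((Submodule.mem_bot K).1 h) a
      simp [h']
    · exact (Submodule.mem_bot K).2 (funext fun a => h.2 _ (hf a))
  · intro y hy
    -- Words are linear over the invariants `y a`, so duality of `b` and `f` recovers `y`.
    refine ⟨∑ a, y a * (b a : χ.NicholsAlgebra), ⟨Submodule.sum_mem _ fun a _ => ?_,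
      fun g hg => ?_⟩, (Submodule.mem_bot K).2 (sub_eq_zero.2 (funext fun c => ?_))⟩
    · rw [add_comm]
      exact χ.mul_mem_degree (hy a trivial).2 (b a).2.2
    · rw [map_sum]
      refine Finset.sum_eq_zero fun a _ => ?_
      rw [wordSpan_mul (hy a trivial).1 hg, wordSpan_eq_zero_of_lt hg (Nat.lt_succ_self j) (b a).2.2,
        mul_zero]
    · rw [LinearMap.pi_apply, map_sum, Finset.sum_eq_single c]
      · rw [wordSpan_mul (hy c trivial).1 (hf c), wordSpan_apply_subalgebraDegree (hf c), hdual]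
        simp
      · intro a _ hac
        rw [wordSpan_mul (hy a trivial).1 (hf c), wordSpan_apply_subalgebraDegree (hf c), hdual,
          if_neg hac.symm, map_zero, mul_zero]
      · simp

theorem finrank_degree (hS : IsSubrack S) (n : ℕ) :
    Module.finrank K (χ.degree n) = ∑ p ∈ Finset.HasAntidiagonal.antidiagonal n,
      Module.finrank K (χ.subalgebraDegree S p.1) *
        Module.finrank K ↥(χ.invariants S ⊓ χ.degree p.2) := by
  have h : ∀ j ≤ n + 1, Module.finrank K (χ.wordFiltration S j n) =
      ∑ k ∈ Finset.range j, Module.finrank K (χ.subalgebraDegree S k) *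
        Module.finrank K ↥(χ.invariants S ⊓ χ.degree (n - k)) := by
    intro j hj
    induction j with
    | zero =>
      have : χ.wordFiltration S 0 n = ⊥ := (Submodule.eq_bot_iff _).2 fun x hx =>
        hx.2 LinearMap.id (wordR_mem_wordSpan (l := []) (by simp))
      simp [this]
    | succ j ih =>
      obtain ⟨i, rfl⟩ := Nat.exists_eq_add_of_le (Nat.le_of_succ_le_succ hj)
      rw [Finset.sum_range_succ, ← ih (by lia), finrank_wordFiltration_succ hS, add_comm,
        Nat.add_sub_cancel_left]
  have htop : χ.wordFiltration S (n + 1) n = χ.degree n := le_antisymm (fun x hx => hx.1)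
    fun x hx => ⟨hx, fun f hf => wordSpan_eq_zero_of_lt hf (Nat.lt_succ_self n) hx⟩
  rw [← htop, h _ le_rfl, Finset.Nat.sum_antidiagonal_eq_sum_range_succ_mk]

theorem hilbertSeries_eq_mul (hS : IsSubrack S) :
    χ.hilbertSeries ⊤ = χ.hilbertSeries (Subalgebra.toSubmodule (χ.nicholsSubalgebra S)) *
      χ.hilbertSeries (χ.invariants S) := by
  ext n
  simp only [hilbertSeries, PowerSeries.coeff_mul, PowerSeries.coeff_mk]
  rw [show ⊤ ⊓ χ.degree n = χ.degree n from top_inf_eq _, finrank_degree hS]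
  push_cast
  rfl

end

end RackCocycle

/-! ### Graded modules over the quantum Weyl algebra -/

section QuantumWeyl

variable {K M : Type*} [Field K] [AddCommGroup M] [Module K M]

theorem pow_succ_apply_of_skew_commute {D E : Module.End K M} {q : K}
    (hDE : ∀ x, D (E x) = x + q • E (D x)) (i : ℕ) (x : M) :
    (D ^ (i + 1)) (E x) =
      q ^ (i + 1) • E ((D ^ (i + 1)) x) + (∑ k ∈ Finset.range (i + 1), q ^ k) • (D ^ i) x := by
  induction i generalizing x with
  | zero => simp [hDE, add_comm]
  | succ i ih =>
    rw [pow_succ D (i + 1), Module.End.mul_apply, hDE, map_add, map_smul, ih,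
      Finset.sum_range_succ' _ (i + 1)]
    simp only [pow_succ (D : Module.End K M), Module.End.mul_apply, smul_add, smul_smul, pow_zero,
      add_smul, one_smul, Finset.mul_sum, ← pow_succ' q]
    abel

/-- If the sum vanishes then $q^i=1$. This holds in every characteristic; for $q=1$ the hypothesis
is never met. -/
theorem geom_sum_orderOf_ne_zero {q : Kˣ} {i : ℕ} (hi : ¬ orderOf q ∣ i) :
    ∑ k ∈ Finset.range i, (q : K) ^ k ≠ 0 := by
  intro h
  have h' := geom_sum_mul (q : K) i
  rw [h, zero_mul, eq_comm, sub_eq_zero] at h'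
  exact hi (orderOf_dvd_of_pow_eq_one (Units.ext (by simpa using h')))

theorem PowerSeries.exists_polynomial_of_coeff_eq_zero {P : PowerSeries ℤ} {N : ℕ}
    (h : ∀ n, N < n → PowerSeries.coeff n P = 0) : ∃ p : Polynomial ℤ, (p : PowerSeries ℤ) = P := by
  refine ⟨PowerSeries.trunc (N + 1) P, ?_⟩
  ext n
  rw [Polynomial.coeff_coe, PowerSeries.coeff_trunc]
  split_ifs with hn
  · rfl
  · exact (h n (by lia)).symm

/-- A finite-dimensional graded representation of the quantum Weyl algebra at a root of unity of
order `m` has a Hilbert series divisible by `1 + t + ⋯ + t ^ (m - 1)`. -/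
theorem exists_finrank_eq_geom_sum_mul (U : ℕ → Submodule K M) [∀ n, FiniteDimensional K (U n)]
    (D E : Module.End K M) (q : Kˣ) (hD0 : ∀ x ∈ U 0, D x = 0)
    (hD : ∀ n, ∀ x ∈ U (n + 1), D x ∈ U n) (hE : ∀ n, ∀ x ∈ U n, E x ∈ U (n + 1))
    (hDE : ∀ x, D (E x) = x + (q : K) • E (D x)) {N : ℕ} (hN : ∀ n, N < n → U n = ⊥) :
    ∃ p : Polynomial ℤ, PowerSeries.mk (fun n => (Module.finrank K (U n) : ℤ)) =
      (∑ j ∈ Finset.range (orderOf q), (PowerSeries.X : PowerSeries ℤ) ^ j) * p := by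
  let F (i n : ℕ) : Submodule K M := U n ⊓ LinearMap.ker (D ^ i)
  let s (i : ℕ) : PowerSeries ℤ := PowerSeries.mk fun n => (Module.finrank K (F i n) : ℤ)
  let A (i : ℕ) : PowerSeries ℤ := s (i + 1) - s i
  have hker : ∀ {n i : ℕ} {x : M}, x ∈ U n → n < i → (D ^ i) x = 0 := by
    intro n
    induction n with
    | zero =>
      intro i x hx hi
      obtain ⟨i, rfl⟩ := Nat.exists_eq_succ_of_ne_zero hi.ne'
      rw [pow_succ, Module.End.mul_apply, hD0 x hx, map_zero]
    | succ n ih =>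
      intro i x hx hi
      obtain ⟨i, rfl⟩ := Nat.exists_eq_succ_of_ne_zero (Nat.ne_zero_of_lt hi)
      rw [pow_succ, Module.End.mul_apply]
      exact ih (hD n x hx) (by lia)
  have hFU : ∀ {n i : ℕ}, n < i → F i n = U n := fun hi =>
    inf_eq_left.2 fun x hx => hker hx hi
  have hFbot : ∀ {n i : ℕ}, N < n → F i n = ⊥ := fun hn => by
    rw [eq_bot_iff, ← hN _ hn]; exact inf_le_left
  have hs : ∀ i, N < i → s i = PowerSeries.mk fun n => (Module.finrank K (U n) : ℤ) := by
    intro i hi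
    ext n
    simp only [s, PowerSeries.coeff_mk]
    rcases lt_or_ge N n with hn | hn
    · rw [hFbot hn, hN n hn]
    · rw [hFU (by lia)]
  have hs0 : s 0 = 0 := by
    ext n
    have : F 0 n = ⊥ := (Submodule.eq_bot_iff _).2 fun x hx => hx.2
    simp [s, this]
  -- `D` embeds each layer $\ker D^{i+2}/\ker D^{i+1}$ into the layer below, one degree lower. It is
  -- onto when $(i+1)_q\neq0$, since $D^{i+1}E=(i+1)_qD^i$ on $\ker D^{i+1}$.
  have hA : ∀ i, ¬ orderOf q ∣ i + 1 → A (i + 1) = PowerSeries.X * A i := by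
    intro i hi
    ext n
    cases n with
    | zero =>
      simp only [A, s, map_sub, PowerSeries.coeff_mk]
      rw [hFU (Nat.succ_pos (i + 1)), hFU (Nat.succ_pos i), sub_self]
      simp
    | succ n =>
      rw [PowerSeries.coeff_succ_X_mul]
      have hc := geom_sum_orderOf_ne_zero hi
      have h := LinearMap.finrank_add_finrank_of_induced_equiv D
        (A := F (i + 2) (n + 1)) (A' := F (i + 1) (n + 1)) (C := F (i + 1) n) (C' := F i n)
        (fun x hx => ⟨hx.1, ?_⟩) (fun x hx => ⟨hx.1, ?_⟩) (fun x hx => ⟨hD n x hx.1, ?_⟩)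
        (fun x hx => ?_) (fun y hy => ?_)
      · simp only [A, s, map_sub, PowerSeries.coeff_mk]
        have h' := congrArg (Nat.cast : ℕ → ℤ) h
        push_cast at h'
        linarith
      · change (D ^ (i + 2)) x = 0
        rw [pow_succ', Module.End.mul_apply, hx.2, map_zero]
      · change (D ^ (i + 1)) x = 0
        rw [pow_succ', Module.End.mul_apply, hx.2, map_zero]
      · change (D ^ (i + 1)) (D x) = 0
        rw [← Module.End.mul_apply, ← pow_succ]; exact hx.2
      · refine ⟨fun h => ⟨hx.1, ?_⟩, fun h => ⟨hD n x hx.1, ?_⟩⟩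
        · change (D ^ (i + 1)) x = 0
          rw [pow_succ, Module.End.mul_apply]; exact h.2
        · change (D ^ i) (D x) = 0
          rw [← Module.End.mul_apply, ← pow_succ]; exact h.2
      · have hy1 : (D ^ (i + 1)) y = 0 := hy.2
        have hy2 : (D ^ (i + 2)) y = 0 := by
          rw [pow_succ', Module.End.mul_apply, hy1, map_zero]
        have hx1 : (D ^ (i + 1)) ((∑ k ∈ Finset.range (i + 1), (q : K) ^ k)⁻¹ • E y) =
            (D ^ i) y := by
          rw [map_smul, pow_succ_apply_of_skew_commute hDE, hy1, map_zero, smul_zero, zero_add,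
            smul_smul, inv_mul_cancel₀ hc, one_smul]
        refine ⟨(∑ k ∈ Finset.range (i + 1), (q : K) ^ k)⁻¹ • E y,
          ⟨Submodule.smul_mem _ _ (hE n y hy.1), ?_⟩,
          sub_mem (hD n _ (Submodule.smul_mem _ _ (hE n y hy.1))) hy.1, ?_⟩
        · change (D ^ (i + 2)) _ = 0
          rw [map_smul, pow_succ_apply_of_skew_commute hDE, hy2, hy1]
          simp
        · change (D ^ i) _ = 0
          rw [map_sub, ← Module.End.mul_apply, ← pow_succ, hx1, sub_self]
  have hApoly : ∀ i n, N < n → PowerSeries.coeff n (A i) = 0 := fun i n hn => by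
    simp only [A, s, map_sub, PowerSeries.coeff_mk]
    rw [hFbot hn, hFbot hn, sub_self]
  obtain hm | hm := Nat.eq_zero_or_pos (orderOf q)
  -- Infinite order: all layers are shifts of the first, but those beyond `N` vanish, so the whole
  -- series is zero, matching the empty geometric sum.
  · have hpow : ∀ i, A i = PowerSeries.X ^ i * A 0 := by
      intro i
      induction i with
      | zero => simp
      | succ i ih => rw [hA i (by simp [hm]), ih, pow_succ', mul_assoc]
    have hA0 : A 0 = 0 := by
      have h : A (N + 1) = 0 := sub_eq_zero.2 ((hs _ (by lia)).trans (hs _ (by lia)).symm)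
      rw [hpow] at h
      exact (mul_eq_zero.1 h).resolve_left (pow_ne_zero _ PowerSeries.X_ne_zero)
    have hs' : ∀ i, s i = 0 := by
      intro i
      induction i with
      | zero => exact hs0
      | succ i ih =>
        have h : A i = 0 := by rw [hpow, hA0, mul_zero]
        exact (sub_eq_zero.1 h).trans ih
    exact ⟨0, by rw [← hs (N + 1) (by lia), hs', Polynomial.coe_zero, mul_zero]⟩
  -- Finite order: the layers come in blocks of `orderOf q` successive shifts, and each block
  -- contributes a multiple of the geometric sum.
  · have hpow : ∀ k j, j < orderOf q → A (k * orderOf q + j) =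
        PowerSeries.X ^ j * A (k * orderOf q) := by
      intro k j hj
      induction j with
      | zero => simp
      | succ j ih =>
        rw [← add_assoc, hA _ ?_, ih (by lia), pow_succ', mul_assoc]
        rw [add_assoc, (Nat.dvd_add_right (Dvd.intro_left k rfl))]
        exact Nat.not_dvd_of_pos_of_lt (Nat.succ_pos j) hj
    have hsum : ∀ i, s i = ∑ k ∈ Finset.range i, A k := fun i => by
      rw [Finset.sum_range_sub, hs0, sub_zero]
    have hmul : ∀ k, s (k * orderOf q) =
        (∑ j ∈ Finset.range (orderOf q), (PowerSeries.X : PowerSeries ℤ) ^ j) *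
          ∑ i ∈ Finset.range k, A (i * orderOf q) := by
      intro k
      induction k with
      | zero => simp [hs0]
      | succ k ih =>
        rw [hsum, add_mul, one_mul, Finset.sum_range_add, ← hsum, ih, Finset.sum_range_succ,
          mul_add]
        congr 1
        rw [Finset.sum_mul]
        exact Finset.sum_congr rfl fun j hj => hpow k j (Finset.mem_range.1 hj)
    obtain ⟨p, hp⟩ := PowerSeries.exists_polynomial_of_coeff_eq_zero
      (P := ∑ i ∈ Finset.range (N + 1), A (i * orderOf q)) (N := N) fun n hn => by
        rw [map_sum]
        exact Finset.sum_eq_zero fun i _ => hApoly _ n hn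
    exact ⟨p, by rw [hp, ← hmul, hs]; exact Nat.le_mul_of_pos_right _ hm⟩

theorem Polynomial.geom_sum_dvd_of_dvd_natCast_mul {m c : ℕ} (hc : c ≠ 0) {h : Polynomial ℤ}
    (hd : ∑ j ∈ Finset.range m, (Polynomial.X : Polynomial ℤ) ^ j ∣ (c : Polynomial ℤ) * h) :
    ∑ j ∈ Finset.range m, (Polynomial.X : Polynomial ℤ) ^ j ∣ h := by
  obtain rfl | hm := eq_or_ne m 0
  · simpa [hc] using hd
  · have hmonic : (∑ j ∈ Finset.range m, (Polynomial.X : Polynomial ℤ) ^ j).Monic :=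
      Polynomial.monic_geom_sum_X hm
    rw [← Polynomial.modByMonic_eq_zero_iff_dvd hmonic] at hd ⊢
    have hs : (c : Polynomial ℤ) * h = (c : ℤ) • h := by
      rw [Polynomial.smul_eq_C_mul]; simp
    rw [hs, Polynomial.smul_modByMonic] at hd
    exact (smul_eq_zero.1 hd).resolve_left (by exact_mod_cast hc)

end QuantumWeyl


/-! ### Divisibility of the Hilbert series of the invariants -/

namespace RackCocycle

noncomputable section

variable {X K : Type*} [Rack X] [Field K] {χ : RackCocycle X K} [DecidableEq X] {S : Set X}

theorem exists_hilbertSeries_invariants [Finite X] (hfin : Module.Finite K χ.NicholsAlgebra)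
    (hS : IsSubrack S) {t : X} (ht : t ∉ S)
    (hdiag : ∀ s : X, χ.val (s ◃ s) (s ◃ s) = χ.val s s) :
    ∃ p : Polynomial ℤ, χ.hilbertSeries (χ.invariants S) =
      (∑ j ∈ Finset.range (orderOf (χ.val t t)), (PowerSeries.X : PowerSeries ℤ) ^ j) * p := by
  classical
  have := Fintype.ofFinite X
  -- The indices that cannot be told apart from `t`; they stand in for the possibly missing fixed
  -- point $t\triangleright t=t$.
  let O : Type _ := {s : X // s ∉ S ∧ (∀ r, s ◃ r = t ◃ r) ∧ (∀ r, χ.val s r = χ.val t r) ∧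
    χ.val s s = χ.val t t}
  have hO : ∀ s : O, t ◃ s.1 ∉ S ∧ (∀ r, (t ◃ s.1) ◃ r = t ◃ r) ∧
      (∀ r, χ.val (t ◃ s.1) r = χ.val t r) ∧ χ.val (t ◃ s.1) (t ◃ s.1) = χ.val t t := by
    rintro ⟨s, hsS, hs, hsχ, hsq⟩
    -- Self-distributivity and the cocycle identity with both first arguments equal to `s` show that
    -- $s\triangleright s$ acts like $s$ with the same cocycle row. Since $s\triangleright
    -- s=t\triangleright s$, the set `O` is stable under `t`.
    have hact : ∀ r, (s ◃ s) ◃ r = s ◃ r := fun r => by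
      obtain ⟨r, rfl⟩ := (Rack.act' s).surjective r
      exact (Shelf.self_distrib (x := s) (y := s) (z := r)).symm
    have hval : ∀ r, χ.val (s ◃ s) r = χ.val s r := fun r => by
      obtain ⟨r, rfl⟩ := (Rack.act' s).surjective r
      exact (mul_right_cancel (χ.cocycle s s r)).symm
    dsimp only
    rw [← hs s]
    refine ⟨fun h => hsS ?_, fun r => (hact r).trans (hs r), fun r => (hval r).trans (hsχ r),
      (hdiag s).trans hsq⟩
    -- If $s\triangleright s\in S$, its bijective action on `S` gives $r\in S$ with $s\triangleright
    -- r=s\triangleright s$, whence $s=r\in S$.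
    obtain ⟨r, hr, hrs⟩ := (hS _ h).surjOn h
    rwa [← (Rack.act' s).injective ((hact r).symm.trans hrs)]
  let σ : Equiv.Perm O := Equiv.ofBijective (fun s => ⟨t ◃ s.1, hO s⟩)
    (Finite.injective_iff_bijective.1 fun s s' h =>
      Subtype.ext ((Rack.act' t).injective (congrArg Subtype.val h)))
  have hσ : ∀ s : O, (σ s : X) = t ◃ s.1 := fun _ => rfl
  -- All elements of `O` act alike, so the sum satisfies a Weyl relation for every `s` in `O`, with
  -- only the index of the derivation shifted by `σ`.
  let E : Module.End K χ.NicholsAlgebra := ∑ u : O, LinearMap.mulLeft K (χ.gen u)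
  have hE : ∀ (s : O) (x : χ.NicholsAlgebra),
      χ.skewL (σ s) (E x) = x + (χ.val t t : K) • E (χ.skewL s x) := by
    intro s x
    have h : ∀ u : O, χ.skewL (σ s) (χ.gen u * x) =
        (if u = σ s then x else 0) + (χ.val t t : K) • (χ.gen u * χ.skewL s x) := by
      intro u
      rw [χ.skewL_gen_mul (s := s.1) ((u.2.2.1 s.1).trans (hσ s).symm), u.2.2.2.1,
        (s.2.2.2.1 s.1).symm.trans s.2.2.2.2]
      by_cases hus : u = σ s
      · rw [if_pos hus, if_pos (congrArg Subtype.val hus)]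
      · rw [if_neg hus, if_neg fun h => hus (Subtype.ext h)]
    simp only [E, LinearMap.sum_apply, LinearMap.mulLeft_apply, map_sum, h, Finset.sum_add_distrib,
      Finset.smul_sum]
    rw [Finset.sum_eq_single (σ s) (fun u _ hu => if_neg hu) (by simp), if_pos rfl]
  have hEinv : ∀ x ∈ χ.invariants S, E x ∈ χ.invariants S := by
    intro x hx s hs
    simp only [E, LinearMap.sum_apply, LinearMap.mulLeft_apply, map_sum]
    refine Finset.sum_eq_zero fun u _ => ?_
    rw [skewR_mul, hx s hs, skewR_gen, if_neg fun h : u.1 = s => u.2.1 (h ▸ hs), mul_zero,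
      zero_mul, add_zero]
  have hEdeg : ∀ n, ∀ x ∈ χ.degree n, E x ∈ χ.degree (n + 1) := by
    intro n x hx
    simp only [E, LinearMap.sum_apply, LinearMap.mulLeft_apply]
    refine Submodule.sum_mem _ fun u _ => ?_
    rw [add_comm]
    exact χ.mul_mem_degree (χ.gen_mem_degree u) hx
  have hLinv : ∀ s, ∀ x ∈ χ.invariants S, χ.skewL s x ∈ χ.invariants S := fun s x hx r hr => by
    rw [← skewL_skewR, hx r hr, map_zero]
  let W (n : ℕ) : Submodule K χ.NicholsAlgebra := χ.invariants S ⊓ χ.degree n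
  let U (n : ℕ) : Submodule K (O → χ.NicholsAlgebra) := Submodule.pi Set.univ fun _ => W n
  -- Permuting the coordinates by `σ` in `D` and by its inverse in `E'` absorbs the index shift and
  -- yields the exact relation $DE'=1+qE'D$.
  let D : Module.End K (O → χ.NicholsAlgebra) :=
    LinearMap.pi fun s => χ.skewL (σ s) ∘ₗ LinearMap.proj (σ s)
  let E' : Module.End K (O → χ.NicholsAlgebra) :=
    LinearMap.pi fun s => E ∘ₗ LinearMap.proj (σ.symm s)
  obtain ⟨N, hN⟩ := χ.exists_degree_eq_bot
  have hW : ∀ n, N < n → W n = ⊥ := fun n hn => by simp [W, hN n hn]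
  obtain ⟨p, hp⟩ := exists_finrank_eq_geom_sum_mul U D E' (χ.val t t)
    (fun x hx => funext fun s => χ.skewL_eq_zero _ (hx _ trivial).2)
    (fun n x hx s _ => ⟨hLinv _ _ (hx _ trivial).1, χ.skewL_mem_degree _ (hx _ trivial).2⟩)
    (fun n x hx s _ => ⟨hEinv _ (hx _ trivial).1, hEdeg n _ (hx _ trivial).2⟩)
    (fun x => funext fun s => by simp [D, E', hE]) (N := N)
    (fun n hn => (Submodule.eq_bot_iff _).2 fun x hx => funext fun s =>
      (Submodule.mem_bot K).1 (hW n hn ▸ hx s trivial))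
  obtain ⟨h, hh⟩ := PowerSeries.exists_polynomial_of_coeff_eq_zero
    (P := χ.hilbertSeries (χ.invariants S)) (N := N) fun n hn => by
      rw [hilbertSeries, PowerSeries.coeff_mk]
      change (Module.finrank K (W n) : ℤ) = 0
      rw [hW n hn, finrank_bot, Nat.cast_zero]
  have hgeom : ((∑ j ∈ Finset.range (orderOf (χ.val t t)), (Polynomial.X : Polynomial ℤ) ^ j :
      Polynomial ℤ) : PowerSeries ℤ) = ∑ j ∈ Finset.range (orderOf (χ.val t t)),
        (PowerSeries.X : PowerSeries ℤ) ^ j := by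
    rw [← Polynomial.coeToPowerSeries.ringHom_apply, map_sum]
    simp
  have hcard : Fintype.card O ≠ 0 :=
    @Fintype.card_ne_zero O _ ⟨⟨t, ht, fun _ => rfl, fun _ => rfl, rfl⟩⟩
  have hdvd : ∑ j ∈ Finset.range (orderOf (χ.val t t)), (Polynomial.X : Polynomial ℤ) ^ j ∣
      (Fintype.card O : Polynomial ℤ) * h := by
    refine ⟨p, Polynomial.coe_injective ℤ ?_⟩
    have hl : PowerSeries.mk (fun n => (Module.finrank K (U n) : ℤ)) =
        (Fintype.card O : PowerSeries ℤ) * χ.hilbertSeries (χ.invariants S) := by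
      ext n
      rw [← nsmul_eq_mul, map_nsmul, hilbertSeries, PowerSeries.coeff_mk, PowerSeries.coeff_mk,
        Submodule.finrank_pi_univ, nsmul_eq_mul]
      push_cast
      rfl
    rw [hl, ← hh] at hp
    rw [Polynomial.coe_mul, Polynomial.coe_mul, hgeom, ← hp,
      ← Polynomial.coeToPowerSeries.ringHom_apply, map_natCast]
  obtain ⟨r, hr⟩ := Polynomial.geom_sum_dvd_of_dvd_natCast_mul hcard hdvd
  refine ⟨r, ?_⟩
  rw [← hh, hr, Polynomial.coe_mul, hgeom]

end

end RackCocycle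

theorem mainTheorem3 {X K : Type*} [Rack X] [Finite X] [Field K] (χ : RackCocycle X K)
    (m : ℕ) (hm : ∀ t : X, orderOf (χ.val t t) = m)
    (hdiag : ∀ t : X, χ.val (t ◃ t) (t ◃ t) = χ.val t t)
    (hfin : Module.Finite K χ.NicholsAlgebra)
    (X' : Set X) (hX' : IsSubrack X') (hne : X'.Nonempty) (hproper : X' ≠ Set.univ) :
    ∃ p : Polynomial ℤ,
      χ.hilbertSeries ⊤ =
        (∑ j ∈ Finset.range m, (PowerSeries.X : PowerSeries ℤ) ^ j) *
          χ.hilbertSeries (Subalgebra.toSubmodule (χ.nicholsSubalgebra X')) *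
          (p : PowerSeries ℤ) := by
  classical
  obtain ⟨t, ht⟩ := (Set.ne_univ_iff_exists_notMem X').1 hproper
  obtain ⟨p, hp⟩ := RackCocycle.exists_hilbertSeries_invariants hfin hX' ht hdiag
  refine ⟨p, ?_⟩
  rw [RackCocycle.hilbertSeries_eq_mul hX', hp, hm t]
  ring
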